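/- **Setting.** Let $d\ge 0$. For a function $h=(h^j)_j:\mathbb R^d\to\mathbb R^d$ write $\nabla h=[\partial_i h^j]_{i,j}$ (the transposed Jacobian), $A'$ for the transpose of a matrix $A$, $A\le B$ when $B-A$ is symmetric positive semidefinite, $A>0$ when $A$ is symmetric positive definite, and $v^{1/2}$ for the principal square root. For $\varpi>0$ put $$\mathrm{Ricc}_\varpi(s)=(I+(\varpi+s)^{-1})^{-1},\qquad r_\varpi=-\tfrac{\varpi}{2}+\Big(\varpi+\big(\tfrac{\varpi}{2}\big)^2\Big)^{1/2},$$ so that $r_\varpi>0$ is a fixed point of $\mathrm{Ricc}_\varpi$; when "$\varpi^{-1}=0$" the convention is $r_\varpi=I$. Let $U,V:\mathbb R^d\to\mathbb R$ be $C^2$ with $\mu(dx)=e^{-U(x)}dx$ and $\eta(dy)=e^{-V(y)}dy$ probability measures. Let $\alpha\in\mathbb R^d$, let $\beta$ be an invertible $d\times d$ matrix, $\tau>0$, $\chi:=\tau^{-1}\beta$, and $W(x,y)=-\log g_\tau(y-(\alpha+\beta x))$, with $g_\tau$ the density of the centered Gaussian law with covariance $\tau$. For a potential $F$ let $K_F(x,dy)=e^{-F(x,y)}dy$,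 and $W^\flat(y,x)=W(x,y)$. Let $(\mathbb U,\mathbb V)$ be measurable real functions solving the Schrödinger system $$\mathbb U=U+\log K_W(e^{-\mathbb V}),\qquad \mathbb V=V+\log K_{W^\flat}(e^{-\mathbb U})$$ at every point of $\mathbb R^d$ (all integrals being finite), and define the transition potentials by $$U(x)+\mathbb W_{\mu,\eta}(x,y)=\mathbb U(x)+W(x,y)+\mathbb V(y)=V(y)+\mathbb W^\flat_{\eta,\mu}(y,x).$$ Write $K=K_{\mathbb W_{\mu,\eta}}$, $K^\flat=K_{\mathbb W^\flat_{\eta,\mu}}$, $K(I)(x)=\int y\,K(x,dy)$ (the entropic map, or barycentric projection), and $\Sigma_{\mu,\eta}(x)=\frac12\int K(x,dy)K(x,dz)(y-z)(y-z)'$; $K^\flat(I)$ and $\Sigma^\flat_{\eta,\mu}$ are defined in the same way from $K^\flat$. **Theorem.** 0. $K$ and $K^\flat$ are Markov transitions and $\eta(dy)K^\flat(y,dx)=\mu(dx)K(x,dy)$. If some coupling of $\mu$ and $\eta$ has finite relative entropy with respect to $P=\mu\times K_W$, then $\mu\times K$ is the unique Schrödinger bridge $P_{\mu,\eta}$, i.e.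 the unique finite-entropy minimiser of $Q\mapsto\mathcal H(Q|P)$ over the couplings $Q$ of $\mu$ and $\eta$. The measures $K(x,\cdot)$ and $K^\flat(y,\cdot)$ have finite second moments, and $K(I)$ and $K^\flat(I)$ are differentiable. 1. (Conditional covariance identities.) At every point, $$\chi'\,\Sigma_{\mu,\eta}\,\chi=\nabla K(I)\,\chi,\qquad \chi\,\Sigma^\flat_{\eta,\mu}\,\chi'=\nabla K^\flat(I)\,\chi'.$$ 2. Let $v_+>0$, and let $u_->0$ or $u_-=0$. Assume $\nabla^2U\le u_-^{-1}$ (no condition if $u_-=0$) and $v_+^{-1}\le\nabla^2V$ everywhere. Then, at every point, $$\nabla K(I)\,\chi\le\chi'v_+^{1/2}\,r_{\overline\varpi_0}\,v_+^{1/2}\chi,\qquad \nabla K^\flat(I)\,\chi'\ge\chi\,u_-^{1/2}\,r_{\varpi_1}\,u_-^{1/2}\chi',$$ where $\overline\varpi_0^{-1}=v_+^{1/2}\chi u_-\chi'v_+^{1/2}$ and $\varpi_1^{-1}=u_-^{1/2}\chi'v_+\chi u_-^{1/2}$. 3. Let $u_+>0$, and let $v_->0$ or $v_-=0$. Assume $u_+^{-1}\le\nabla^2U$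 and $\nabla^2V\le v_-^{-1}$ (no condition if $v_-=0$) everywhere. Then, at every point, $$\nabla K^\flat(I)\,\chi'\le\chi\,u_+^{1/2}\,r_{\overline\varpi_1}\,u_+^{1/2}\chi',\qquad \nabla K(I)\,\chi\ge\chi'v_-^{1/2}\,r_{\varpi_0}\,v_-^{1/2}\chi,$$ where $\overline\varpi_1^{-1}=u_+^{1/2}\chi'v_-\chi u_+^{1/2}$ and $\varpi_0^{-1}=v_-^{1/2}\chi u_+\chi'v_-^{1/2}$. In particular, if the hypotheses of 2 and 3 both hold, then all four bounds (the two-sided form) hold. -/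

import Mathlib

open MeasureTheory ProbabilityTheory Matrix
open scoped MatrixOrder

noncomputable section

namespace EntropicMap

/-- `ℝᵈ` as a space of column vectors. No definition below depends on the choice of a norm. -/
abbrev Vec (d : ℕ) : Type := Fin d → ℝ

/-- Real `d × d` matrices; `A ≤ B` on them is the Loewner order (`B - A` is symmetric positive
semidefinite), `Aᵀ` is the transpose and `A⁻¹` the inverse. -/
abbrev Mat (d : ℕ) : Type := Matrix (Fin d) (Fin d) ℝ

variable {d : ℕ}

/-! ### Gradients and Hessians -/

/-- The gradient column vector `(∂ᵢ f)ᵢ` of a scalar function. -/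
def grad (f : Vec d → ℝ) (x : Vec d) : Vec d :=
  fun i => fderiv ℝ f x (Pi.single i 1)

/-- The gradient matrix `∇h = [∇h¹, …, ∇hᵈ]` of a vector valued function, that is
`(∇h)ᵢⱼ = ∂ᵢ hʲ` (the transpose of the Jacobian matrix). -/
def gradMat (h : Vec d → Vec d) (x : Vec d) : Mat d :=
  Matrix.of fun i j => fderiv ℝ h x (Pi.single i 1) j

/-- The Hessian matrix `∇²f = ∇(∇f)`. -/
def hess (f : Vec d → ℝ) (x : Vec d) : Mat d := gradMat (grad f) x

/-! ### Riccati maps -/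

/-- The principal square root `v^{1/2}` of a positive semidefinite matrix. -/
abbrev msqrt (v : Mat d) : Mat d := CFC.sqrt v

/-- The Riccati map `Ricc_ϖ(s) = (I + (ϖ + s)⁻¹)⁻¹`. -/
def ricc (ϖ s : Mat d) : Mat d := (1 + (ϖ + s)⁻¹)⁻¹

/-- The closed form `-ϖ/2 + (ϖ + (ϖ/2)²)^{1/2}` of the positive definite fixed point of `Ricc_ϖ`. -/
def riccFix (ϖ : Mat d) : Mat d :=
  -((1 / 2 : ℝ) • ϖ) + msqrt (ϖ + ((1 / 2 : ℝ) • ϖ) ^ 2)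

/-- The matrix `riccFix ϖ` is a positive definite fixed point of `Ricc_ϖ`. -/
theorem riccFix_spec {ϖ : Mat d} (h : ϖ.PosDef) :
    (riccFix ϖ).PosDef ∧ ricc ϖ (riccFix ϖ) = riccFix ϖ := by
  have hh : ((1 / 2 : ℝ) • ϖ).PosDef := h.smul (by norm_num)
  have hsq : (((1 / 2 : ℝ) • ϖ) ^ 2).PosSemidef := hh.posSemidef.pow 2
  have hA : (ϖ + ((1 / 2 : ℝ) • ϖ) ^ 2).PosDef := h.add_posSemidef hsq
  have hA0 : 0 ≤ ϖ + ((1 / 2 : ℝ) • ϖ) ^ 2 := hA.posSemidef.nonneg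
  set S : Mat d := msqrt (ϖ + ((1 / 2 : ℝ) • ϖ) ^ 2) with hS
  have hSS : S * S = ϖ + ((1 / 2 : ℝ) • ϖ) ^ 2 := CFC.sqrt_mul_sqrt_self _ hA0
  have hS0 : S.PosSemidef := (CFC.sqrt_nonneg _).posSemidef
  have hcomm : Commute S ϖ := by
    have h1 : Commute (ϖ + ((1 / 2 : ℝ) • ϖ) ^ 2) ϖ :=
      (Commute.refl ϖ).add_left (((Commute.refl ϖ).smul_left _).pow_left 2)
    have h2 := h1.cfcₙ_nnreal NNReal.sqrt
    exact h2
  have hr : riccFix ϖ = S - (1 / 2 : ℝ) • ϖ := by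
    simp only [riccFix, ← hS]
    abel
  have hsum : ϖ + riccFix ϖ = S + (1 / 2 : ℝ) • ϖ := by
    rw [hr]
    module
  have hu : (ϖ + riccFix ϖ).PosDef := by
    rw [hsum]
    exact PosDef.posSemidef_add hS0 hh
  have hmul : riccFix ϖ * (ϖ + riccFix ϖ) = ϖ := by
    have h3 : S * ϖ = ϖ * S := hcomm
    rw [hsum, hr, mul_add, sub_mul, sub_mul, hSS]
    simp only [mul_smul_comm, smul_mul_assoc, h3, sq]
    abel
  have hdet : IsUnit (ϖ + riccFix ϖ).det := (Matrix.isUnit_iff_isUnit_det _).mp hu.isUnit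
  have hreq : ϖ * (ϖ + riccFix ϖ)⁻¹ = riccFix ϖ := by
    have h4 := Matrix.mul_nonsing_inv_cancel_right (ϖ + riccFix ϖ) (riccFix ϖ) hdet
    rwa [hmul] at h4
  have hfix : ricc ϖ (riccFix ϖ) = riccFix ϖ := by
    refine Matrix.inv_eq_left_inv ?_
    rw [mul_add, mul_one]
    nth_rewrite 1 [← hreq]
    rw [← add_mul]
    exact Matrix.mul_nonsing_inv _ hdet
  refine ⟨?_, hfix⟩
  rw [← hfix]
  exact (PosDef.one.add hu.inv).inv

open Classical in
/-- The matrix `r_ϖ` as a function of `ω = ϖ⁻¹`, with the convention `r_ϖ = I` when `ϖ⁻¹ = 0`. -/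
def riccFixOfInv (ω : Mat d) : Mat d := if ω = 0 then 1 else riccFix ω⁻¹

/-! ### Gibbs measures, Gibbs kernels, conditional means and covariances -/

/-- `λ_U(dx) = e^{-U(x)} dx`. -/
def gibbs (U : Vec d → ℝ) : Measure (Vec d) :=
  volume.withDensity fun x => ENNReal.ofReal (Real.exp (-U x))

/-- `K_W(x, dy) = e^{-W(x,y)} dy`, for a measurable `W`. -/
def gibbsKernel (W : Vec d → Vec d → ℝ) : Kernel (Vec d) (Vec d) :=
  (Kernel.const (Vec d) volume).withDensity fun x y => ENNReal.ofReal (Real.exp (-W x y))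

instance (W : Vec d → Vec d → ℝ) : IsSFiniteKernel (gibbsKernel W) := by
  exact inferInstanceAs (IsSFiniteKernel ((Kernel.const (Vec d) volume).withDensity
    fun x y => ((Real.exp (-W x y)).toNNReal : ENNReal)))

/-- `W♭(y,x) = W(x,y)`. -/
def flat (W : Vec d → Vec d → ℝ) : Vec d → Vec d → ℝ := fun y x => W x y

/-- The barycentric projection `K(I)(x) = ∫ K(x, dy) y`. -/
def bary (K : Kernel (Vec d) (Vec d)) (x : Vec d) : Vec d := ∫ y, y ∂(K x)

/-- The conditional covariance matrix `½ ∫ K(x,dy) K(x,dz) (y - z)(y - z)'`. -/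
def condCov (K : Kernel (Vec d) (Vec d)) (x : Vec d) : Mat d :=
  Matrix.of fun i j =>
    (1 / 2 : ℝ) * ∫ p, (p.1 i - p.2 i) * (p.1 j - p.2 j) ∂((K x).prod (K x))

/-! ### The linear-Gaussian reference -/

/-- The density `g_τ` of the centered Gaussian law on `ℝᵈ` with covariance matrix `τ > 0`. -/
def gaussDensity (τ : Mat d) (z : Vec d) : ℝ :=
  (√((2 * Real.pi) • τ).det)⁻¹ * Real.exp (-(1 / 2) * (z ⬝ᵥ (τ⁻¹ *ᵥ z)))

/-- The linear-Gaussian potential `W(x,y) = -log g_τ(y - (α + β x))`. -/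
def linGaussPot (α : Vec d) (β τ : Mat d) (x y : Vec d) : ℝ :=
  -Real.log (gaussDensity τ (y - (α + β *ᵥ x)))

/-! ### Schrödinger bridges -/

/-- `Q` is a Schrödinger bridge from `μ` to `η` with reference `P`: it has marginals `μ` and `η`,
a finite relative entropy with respect to `P`, and it minimises the relative entropy with respect
to `P` among all measures with these marginals. -/
def IsSchrodingerBridge (P : Measure (Vec d × Vec d)) (μ η : Measure (Vec d))
    (Q : Measure (Vec d × Vec d)) : Prop :=
  Q.fst = μ ∧ Q.snd = η ∧ InformationTheory.klDiv Q P ≠ ⊤ ∧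
    ∀ Q' : Measure (Vec d × Vec d), Q'.fst = μ → Q'.snd = η →
      InformationTheory.klDiv Q P ≤ InformationTheory.klDiv Q' P

/-- `(UU, VV)` solves the Schrödinger system
`UU = U + log K_W(e^{-VV})`, `VV = V + log K_{W♭}(e^{-UU})`, all the integrals being finite. -/
structure IsSchrodingerPotentials (U V : Vec d → ℝ) (W : Vec d → Vec d → ℝ)
    (UU VV : Vec d → ℝ) : Prop where
  measurable_left : Measurable UU
  measurable_right : Measurable VV
  integrable_left : ∀ x, Integrable (fun y => Real.exp (-VV y)) (gibbsKernel W x)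
  integrable_right : ∀ y, Integrable (fun x => Real.exp (-UU x)) (gibbsKernel (flat W) y)
  eq_left : ∀ x, UU x = U x + Real.log (∫ y, Real.exp (-VV y) ∂(gibbsKernel W x))
  eq_right : ∀ y, VV y = V y + Real.log (∫ x, Real.exp (-UU x) ∂(gibbsKernel (flat W) y))

/-- The potential of the forward bridge transition, given by
`U(x) + 𝕎(x,y) = UU(x) + W(x,y) + VV(y)`. -/
def bridgePot (U : Vec d → ℝ) (W : Vec d → Vec d → ℝ) (UU VV : Vec d → ℝ) (x y : Vec d) : ℝ :=
  UU x + W x y + VV y - U x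

/-- The potential of the backward bridge transition, given by
`V(y) + 𝕎♭(y,x) = UU(x) + W(x,y) + VV(y)`. -/
def bridgePotFlat (V : Vec d → ℝ) (W : Vec d → Vec d → ℝ) (UU VV : Vec d → ℝ) (y x : Vec d) : ℝ :=
  UU x + W x y + VV y - V y

end EntropicMap

end

open EntropicMap

/-!
# Entropic maps of Schrödinger bridges with a linear-Gaussian reference

Up to functions of `x` alone and of `y` alone, the linear-Gaussian potential `W(x,y)` is the
bilinear form `-y · χ x`. Absorbing these functions into the Schrödinger potentials turns the system
into `p(x) = U(x) + Λ_q(χ x)`, `q(y) = V(y) + Λ_p(χ' y)`, where `Λ_q` is the log-Laplace transform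
of `e^{-q(y)} dy` (`IsDualPair`). This form is symmetric under `(U, p, χ) ↔ (V, q, χ')`, and the
forward transition `K(x, ·)` is the member with parameter `χ x` of the exponential family generated
by `e^{-q}`. Hence the entropic map is `∇Λ_q ∘ χ`, and since the derivative of the mean of an
exponential family is its covariance, the conditional covariance identities follow
(`HasExpMoments.hasFDerivAt_mean`, `gradMat_bary`).

For the bounds, `∇²q = ∇²V + χ Σ♭ χ'`, where `Σ♭` is the backward covariance. A lower bound `A` on
`∇²q` gives `Σ ≤ A⁻¹` (`covMat_expTilt_le`) and an upper bound `B` gives `Σ ≥ B⁻¹`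
(`inv_le_covMat_expTilt`). Both use only second differences of `q`. The first comes from the
Prékopa–Leindler inequality (`prekopa_leindler`) applied to the tilts of `e^{-q}` by opposite
parameters `±η`, expanded for small `η`; the second from the Chapman–Robbins inequality, in which
the density is compared with its translate by a small vector. Alternating the two bounds between the
forward and backward covariances iterates the Riccati map, up to a conjugation by `v₊^{1/2}`; the
map contracts towards its fixed point, which yields the upper bound, and the lower bound is one more
application (`riccati_bounds_of_alternating`).

The minimality of the bridge is the Pythagorean identity `H(Q|P) = H(Q|R) + H(R|P)`, with `R` the
joint law of the forward transition, whose log-density with respect to the reference `P` is a sum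
`f(x) + g(y)` (`klDiv_eq_add_klDiv_tilted`). As `f` and `g` need not be integrable separately, the
equality of the integrals of `f(x) + g(y)` under `Q` and `R` is obtained by truncation
(`integrable_add_of_coupling`).
-/

/-! ### The Prékopa–Leindler inequality -/

/-- Compact case of the Brunn–Minkowski inequality on the line: the sets `K + min L` and
`max K + L` overlap only in the point `max K + min L`. -/
lemma volume_add_volume_le_of_isCompact {K L S : Set ℝ} (hK : IsCompact K) (hL : IsCompact L)
    (hK0 : K.Nonempty) (hL0 : L.Nonempty) (h : ∀ a ∈ K, ∀ b ∈ L, a + b ∈ S) :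
    volume K + volume L ≤ volume S := by
  obtain ⟨a, haK, ha⟩ := hK.exists_isGreatest hK0
  obtain ⟨b, hbL, hb⟩ := hL.exists_isLeast hL0
  have h1 : volume ((fun x => -b + x) ⁻¹' K) = volume K := measure_preimage_add _ _ _
  have h2 : volume ((fun x => -a + x) ⁻¹' L) = volume L := measure_preimage_add _ _ _
  have hmK : MeasurableSet ((fun x => -b + x) ⁻¹' K) :=
    hK.measurableSet.preimage (measurable_const_add _)
  have hsub : ((fun x => -b + x) ⁻¹' K) ∪ ((fun x => -a + x) ⁻¹' L) ⊆ S := by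
    rintro x (hx | hx)
    · simpa using h _ hx _ hbL
    · simpa using h _ haK _ hx
  have hdisj : AEDisjoint volume ((fun x => -b + x) ⁻¹' K) ((fun x => -a + x) ⁻¹' L) := by
    refine measure_mono_null (t := {a + b}) ?_ (by simp)
    rintro x ⟨hx1, hx2⟩
    have := ha hx1
    have := hb hx2
    simp only [Set.mem_singleton_iff]
    linarith
  rw [← h1, ← h2, ← measure_union₀' hmK.nullMeasurableSet hdisj]
  exact measure_mono hsub

/-- The Brunn–Minkowski inequality on the line, for midpoints. -/
lemma volume_add_volume_le_two_mul {A B C : Set ℝ} (hA : MeasurableSet A) (hB : MeasurableSet B)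
    (hA0 : A.Nonempty) (hB0 : B.Nonempty) (h : ∀ a ∈ A, ∀ b ∈ B, (a + b) / 2 ∈ C) :
    volume A + volume B ≤ 2 * volume C := by
  have hC : volume ((fun x : ℝ => 2⁻¹ * x) ⁻¹' C) = 2 * volume C := by
    rw [Real.volume_preimage_mul_left (by norm_num)]
    simp
  rw [← hC]
  obtain ⟨a0, ha0⟩ := hA0
  obtain ⟨b0, hb0⟩ := hB0
  rw [hA.measure_eq_iSup_isCompact, hB.measure_eq_iSup_isCompact]
  simp only [iSup_and']
  refine ENNReal.biSup_add_biSup_le' ⟨∅, by simp⟩ ⟨∅, by simp⟩ ?_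
  rintro K ⟨hKA, hK⟩ L ⟨hLB, hL⟩
  have key := volume_add_volume_le_of_isCompact (S := (fun x : ℝ => 2⁻¹ * x) ⁻¹' C)
    (hK.union (isCompact_singleton (x := a0))) (hL.union (isCompact_singleton (x := b0)))
    ⟨a0, by simp⟩ ⟨b0, by simp⟩ (by
      intro a ha b hb
      have ha' : a ∈ A := by
        rcases ha with ha | ha
        · exact hKA ha
        · rw [Set.mem_singleton_iff.1 ha]; exact ha0
      have hb' : b ∈ B := by
        rcases hb with hb | hb
        · exact hLB hb
        · rw [Set.mem_singleton_iff.1 hb]; exact hb0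
      have := h a ha' b hb'
      rw [Set.mem_preimage]
      convert this using 1
      ring)
  exact (add_le_add (measure_mono Set.subset_union_left)
    (measure_mono Set.subset_union_left)).trans key

/-- The layer cake formula for `ℝ≥0∞`-valued functions bounded by one. -/
lemma lintegral_eq_lintegral_Ioo_of_le_one {f : ℝ → ENNReal} (hf : Measurable f)
    (h1 : ∀ x, f x ≤ 1) :
    ∫⁻ x, f x = ∫⁻ t in Set.Ioo (0 : ℝ) 1, volume {x | ENNReal.ofReal t < f x} := by
  have hfin : ∀ x, f x ≠ ⊤ := fun x => ((h1 x).trans_lt ENNReal.one_lt_top).ne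
  have e1 : ∫⁻ x, f x = ∫⁻ x, ENNReal.ofReal (f x).toReal := by
    simp only [ENNReal.ofReal_toReal (hfin _)]
  rw [e1, lintegral_eq_lintegral_meas_lt _ (Filter.Eventually.of_forall fun x =>
    ENNReal.toReal_nonneg) hf.ennreal_toReal.aemeasurable]
  have e2 : ∀ t ∈ Set.Ioi (0 : ℝ), volume {x | t < (f x).toReal}
      = volume {x | ENNReal.ofReal t < f x} := by
    intro t ht
    congr 1
    ext x
    exact (ENNReal.ofReal_lt_iff_lt_toReal (le_of_lt ht) (hfin x)).symm
  rw [setLIntegral_congr_fun measurableSet_Ioi e2]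
  refine le_antisymm ?_ (lintegral_mono_set Set.Ioo_subset_Ioi_self)
  have hU : Set.Ioi (0 : ℝ) = Set.Ioo 0 1 ∪ Set.Ici 1 := by
    rw [Set.Ioo_union_Ici_eq_Ioi one_pos]
  rw [hU]
  refine (lintegral_union_le _ _ _).trans ?_
  have : ∫⁻ t in Set.Ici (1 : ℝ), volume {x | ENNReal.ofReal t < f x} = 0 := by
    rw [setLIntegral_congr_fun measurableSet_Ici (g := fun _ => 0)]
    · simp
    · intro t ht
      have : {x | ENNReal.ofReal t < f x} = ∅ := by
        ext x
        simp only [Set.mem_ofPred_eq, Set.mem_empty_iff_false, iff_false, not_lt]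
        exact (h1 x).trans (by simpa using ht)
      simp [this]
  simp [this]

lemma ENNReal.mul_le_sq_of_add_le_two_mul {a b c : ENNReal} (h : a + b ≤ 2 * c) :
    a * b ≤ c ^ 2 := by
  rcases eq_or_ne c ⊤ with rfl | hc
  · simp
  have hab : a + b ≠ ⊤ := (h.trans_lt (ENNReal.mul_lt_top (by simp) hc.lt_top)).ne
  have ha : a ≠ ⊤ := fun h => hab (by simp [h])
  have hb : b ≠ ⊤ := fun h => hab (by simp [h])
  lift a to NNReal using ha
  lift b to NNReal using hb
  lift c to NNReal using hc
  norm_cast at h ⊢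
  rw [← NNReal.coe_le_coe] at h ⊢
  push_cast at h ⊢
  nlinarith [sq_nonneg ((a : ℝ) - b), a.2, b.2, c.2, mul_self_le_mul_self (by positivity) h]

/-- The one-dimensional inequality, in the additive form available when both functions have
supremum one. -/
lemma lintegral_add_lintegral_le_of_iSup_eq_one {f g h : ℝ → ENNReal} (hf : Measurable f)
    (hg : Measurable g) (hh : Measurable h) (hf1 : ⨆ x, f x = 1) (hg1 : ⨆ x, g x = 1)
    (H : ∀ x y, f x * g y ≤ h ((x + y) / 2) ^ 2) :
    (∫⁻ x, f x) + ∫⁻ x, g x ≤ 2 * ∫⁻ x, h x := by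
  have hfle : ∀ x, f x ≤ 1 := fun x => hf1 ▸ le_iSup f x
  have hgle : ∀ x, g x ≤ 1 := fun x => hg1 ▸ le_iSup g x
  have hmin : ∫⁻ x, min (h x) 1 ≤ ∫⁻ x, h x := lintegral_mono fun x => min_le_left _ _
  refine le_trans ?_ (mul_le_mul_right hmin 2)
  have hsm : ∀ F : ℝ → ENNReal, Measurable fun t : ℝ => volume {x | ENNReal.ofReal t < F x} := by
    intro F
    refine Antitone.measurable fun s t hst => measure_mono fun x hx => ?_
    exact lt_of_le_of_lt (ENNReal.ofReal_le_ofReal hst) hx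
  rw [lintegral_eq_lintegral_Ioo_of_le_one hf hfle, lintegral_eq_lintegral_Ioo_of_le_one hg hgle,
    lintegral_eq_lintegral_Ioo_of_le_one (hh.min measurable_const) fun x => min_le_right _ _,
    ← lintegral_add_left (hsm f), ← lintegral_const_mul _ (hsm _)]
  refine setLIntegral_mono' measurableSet_Ioo fun t ht => ?_
  have ht1 : ENNReal.ofReal t < 1 := by
    rw [ENNReal.ofReal_lt_one]; exact ht.2
  refine volume_add_volume_le_two_mul (measurableSet_lt measurable_const hf)
    (measurableSet_lt measurable_const hg) ?_ ?_ ?_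
  · exact lt_iSup_iff.1 (hf1 ▸ ht1)
  · exact lt_iSup_iff.1 (hg1 ▸ ht1)
  · intro a ha b hb
    simp only [Set.mem_ofPred_eq] at ha hb ⊢
    refine lt_min ?_ ht1
    have := (ENNReal.mul_lt_mul ha hb).trans_le (H a b)
    by_contra hcon
    push Not at hcon
    refine absurd this (not_lt.2 ?_)
    rw [sq]
    exact mul_le_mul' hcon hcon

lemma lintegral_mul_lintegral_le_of_iSup_ne_top {f g h : ℝ → ENNReal} (hf : Measurable f)
    (hg : Measurable g) (hh : Measurable h) (hf1 : ⨆ x, f x ≠ ⊤) (hg1 : ⨆ x, g x ≠ ⊤)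
    (H : ∀ x y, f x * g y ≤ h ((x + y) / 2) ^ 2) :
    (∫⁻ x, f x) * ∫⁻ x, g x ≤ (∫⁻ x, h x) ^ 2 := by
  rcases eq_or_ne (⨆ x, f x) 0 with h0 | hf0
  · have : f = 0 := funext fun x => le_antisymm ((le_iSup f x).trans_eq h0) zero_le
    simp [this]
  rcases eq_or_ne (⨆ x, g x) 0 with h0 | hg0
  · have : g = 0 := funext fun x => le_antisymm ((le_iSup g x).trans_eq h0) zero_le
    simp [this]
  obtain ⟨a, ha⟩ : ∃ a : NNReal, (a : ENNReal) = ⨆ x, f x := ⟨_, ENNReal.coe_toNNReal hf1⟩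
  obtain ⟨b, hb⟩ : ∃ b : NNReal, (b : ENNReal) = ⨆ x, g x := ⟨_, ENNReal.coe_toNNReal hg1⟩
  rw [← ha] at hf0
  rw [← hb] at hg0
  -- divide by the suprema `a` and `b`, and `h` by their geometric mean `c`
  obtain ⟨c, hc⟩ : ∃ c : NNReal, c ^ 2 = a * b := ⟨NNReal.sqrt (a * b), NNReal.sq_sqrt _⟩
  have hcE : (c : ENNReal) ^ 2 = a * b := by exact_mod_cast hc
  have hc0 : (c : ENNReal) ≠ 0 := by
    intro h0
    rw [h0, zero_pow two_ne_zero] at hcE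
    exact mul_ne_zero hf0 hg0 hcE.symm
  have key := ENNReal.mul_le_sq_of_add_le_two_mul <| lintegral_add_lintegral_le_of_iSup_eq_one
    (f := fun x => (a : ENNReal)⁻¹ * f x) (g := fun x => (b : ENNReal)⁻¹ * g x)
    (h := fun x => (c : ENNReal)⁻¹ * h x)
    (hf.const_mul _) (hg.const_mul _) (hh.const_mul _)
    (by rw [← ENNReal.mul_iSup, ← ha]; exact ENNReal.inv_mul_cancel hf0 ENNReal.coe_ne_top)
    (by rw [← ENNReal.mul_iSup, ← hb]; exact ENNReal.inv_mul_cancel hg0 ENNReal.coe_ne_top)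
    (by
      intro x y
      calc (a : ENNReal)⁻¹ * f x * ((b : ENNReal)⁻¹ * g y)
          = ((a : ENNReal)⁻¹ * (b : ENNReal)⁻¹) * (f x * g y) := by ring
        _ ≤ ((a : ENNReal)⁻¹ * (b : ENNReal)⁻¹) * h ((x + y) / 2) ^ 2 := by gcongr; exact H x y
        _ = _ := by
            rw [mul_pow, ← ENNReal.inv_pow, hcE, ENNReal.mul_inv (Or.inl hf0)
              (Or.inl ENNReal.coe_ne_top)])
  rw [lintegral_const_mul _ hf, lintegral_const_mul _ hg, lintegral_const_mul _ hh] at key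
  have e1 : (a : ENNReal) * b * ((a : ENNReal)⁻¹ * (∫⁻ x, f x) * ((b : ENNReal)⁻¹ * ∫⁻ x, g x))
      = (∫⁻ x, f x) * ∫⁻ x, g x := by
    calc _ = ((a : ENNReal) * (a : ENNReal)⁻¹) * ((b : ENNReal) * (b : ENNReal)⁻¹) *
          ((∫⁻ x, f x) * ∫⁻ x, g x) := by ring
      _ = _ := by
        rw [ENNReal.mul_inv_cancel hf0 ENNReal.coe_ne_top,
          ENNReal.mul_inv_cancel hg0 ENNReal.coe_ne_top, one_mul, one_mul]
  have e2 : (a : ENNReal) * b * ((c : ENNReal)⁻¹ * ∫⁻ x, h x) ^ 2 = (∫⁻ x, h x) ^ 2 := by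
    rw [← hcE, ← mul_pow, ← mul_assoc, ENNReal.mul_inv_cancel hc0 ENNReal.coe_ne_top, one_mul]
  rw [← e1, ← e2]
  gcongr

/-- The Prékopa–Leindler inequality on the line, for midpoints. -/
lemma prekopa_leindler_real {f g h : ℝ → ENNReal} (hf : Measurable f)
    (hg : Measurable g) (hh : Measurable h) (H : ∀ x y, f x * g y ≤ h ((x + y) / 2) ^ 2) :
    (∫⁻ x, f x) * ∫⁻ x, g x ≤ (∫⁻ x, h x) ^ 2 := by
  have trunc : ∀ {F : ℝ → ENNReal}, Measurable F →
      ∫⁻ x, F x = ⨆ n : ℕ, ∫⁻ x, min (F x) n := by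
    intro F hF
    rw [← lintegral_iSup (fun n => hF.min measurable_const)
      (fun m n hmn x => min_le_min_left _ (by exact_mod_cast hmn))]
    congr with x
    have : (⨆ n : ℕ, (n : ENNReal)) = ⊤ := ENNReal.iSup_natCast
    rw [← inf_iSup_eq, this, inf_top_eq]
  refine ENNReal.mul_le_of_forall_lt fun a ha b hb => ?_
  rw [trunc hf] at ha
  rw [trunc hg] at hb
  obtain ⟨m, hm⟩ := lt_iSup_iff.1 ha
  obtain ⟨n, hn⟩ := lt_iSup_iff.1 hb
  refine (mul_le_mul' hm.le hn.le).trans ?_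
  refine lintegral_mul_lintegral_le_of_iSup_ne_top (hf.min measurable_const)
    (hg.min measurable_const) hh ?_ ?_ fun x y => ?_
  · exact ((iSup_le fun x => min_le_right _ _).trans_lt (ENNReal.natCast_lt_top m)).ne
  · exact ((iSup_le fun x => min_le_right _ _).trans_lt (ENNReal.natCast_lt_top n)).ne
  · exact (mul_le_mul' (min_le_left _ _) (min_le_left _ _)).trans (H x y)

lemma lintegral_fin_succ {n : ℕ} {f : (Fin (n + 1) → ℝ) → ENNReal} (hf : Measurable f) :
    ∫⁻ x, f x = ∫⁻ s : ℝ, ∫⁻ z : Fin n → ℝ, f (Fin.cons s z) := by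
  have hmp := (volume_preserving_piFinSuccAbove (fun _ : Fin (n + 1) => ℝ) 0).symm
  rw [← hmp.lintegral_comp hf, Measure.volume_eq_prod, lintegral_prod]
  · simp [MeasurableEquiv.piFinSuccAbove, Fin.insertNthEquiv]
  · exact (hf.comp (MeasurableEquiv.measurable _)).aemeasurable

/-- The Prékopa–Leindler inequality on `ℝⁿ`, for midpoints. The partial integrals over the last
`n` coordinates satisfy the hypothesis of the one-dimensional inequality. -/
theorem prekopa_leindler {n : ℕ} {f g h : (Fin n → ℝ) → ENNReal} (hf : Measurable f)
    (hg : Measurable g) (hh : Measurable h)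
    (H : ∀ x y, f x * g y ≤ h ((1 / 2 : ℝ) • (x + y)) ^ 2) :
    (∫⁻ x, f x) * ∫⁻ x, g x ≤ (∫⁻ x, h x) ^ 2 := by
  induction n with
  | zero =>
    have e : ∀ F : (Fin 0 → ℝ) → ENNReal, ∫⁻ x, F x = F 0 := by
      intro F
      rw [Measure.volume_pi_eq_dirac 0, lintegral_dirac]
    rw [e, e, e]
    simpa using H 0 0
  | succ n ih =>
    have hcons : Measurable fun p : ℝ × (Fin n → ℝ) => (Fin.cons p.1 p.2 : Fin (n + 1) → ℝ) := by
      refine measurable_pi_iff.2 fun i => ?_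
      refine Fin.cases ?_ (fun j => ?_) i
      · simpa using measurable_fst
      · simp only [Fin.cons_succ]
        fun_prop
    have hslice : ∀ {F : (Fin (n + 1) → ℝ) → ENNReal}, Measurable F →
        ∀ s, Measurable fun z : Fin n → ℝ => F (Fin.cons s z) := fun hF s =>
      hF.comp (hcons.comp (measurable_const.prodMk measurable_id))
    have hint : ∀ {F : (Fin (n + 1) → ℝ) → ENNReal}, Measurable F →
        Measurable fun s : ℝ => ∫⁻ z : Fin n → ℝ, F (Fin.cons s z) := fun hF =>
      Measurable.lintegral_prod_right' (f := fun p : ℝ × (Fin n → ℝ) => _) (hF.comp hcons)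
    rw [lintegral_fin_succ hf, lintegral_fin_succ hg, lintegral_fin_succ hh]
    refine prekopa_leindler_real (hint hf) (hint hg) (hint hh) fun s t => ?_
    refine ih (hslice hf s) (hslice hg t) (hslice hh _) fun x y => ?_
    refine (H _ _).trans_eq ?_
    congr 2
    ext i
    refine Fin.cases ?_ (fun j => ?_) i
    · simp; ring
    · simp [mul_add]

/-! ### Log-Laplace transforms and exponential tilting -/

namespace EntropicMap

variable {d : ℕ}

/-- The covariance matrix `½ ∫∫ (y - z)(y - z)' π(dy) π(dz)` of a measure. -/
noncomputable def covMat (π : Measure (Vec d)) : Mat d :=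
  Matrix.of fun i j => (1 / 2 : ℝ) * ∫ p, (p.1 i - p.2 i) * (p.1 j - p.2 j) ∂(π.prod π)

/-- All the exponential moments of `ν` are finite. -/
def HasExpMoments (ν : Measure (Vec d)) : Prop :=
  ∀ θ : Vec d, Integrable (fun y => Real.exp (θ ⬝ᵥ y)) ν

/-- The Laplace transform of a measure on `ℝᵈ`. -/
noncomputable def laplace (ν : Measure (Vec d)) (θ : Vec d) : ℝ := ∫ y, Real.exp (θ ⬝ᵥ y) ∂ν

/-- The member of the exponential family generated by `ν` with natural parameter `θ`. -/
noncomputable def expTilt (ν : Measure (Vec d)) (θ : Vec d) : Measure (Vec d) :=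
  ν.tilted fun y => θ ⬝ᵥ y

/-- The linear form `δ ↦ y · δ` as a continuous linear map. -/
noncomputable def dotCLM (y : Vec d) : Vec d →L[ℝ] ℝ :=
  ∑ i, y i • ContinuousLinearMap.proj (R := ℝ) (φ := fun _ : Fin d => ℝ) i

@[simp] lemma dotCLM_apply (y δ : Vec d) : dotCLM y δ = y ⬝ᵥ δ := by
  simp [dotCLM, dotProduct]

lemma continuous_dotCLM : Continuous (dotCLM : Vec d → _) := by
  unfold dotCLM
  fun_prop

lemma abs_dotProduct_le (x y : Vec d) : |x ⬝ᵥ y| ≤ d * ‖x‖ * ‖y‖ := by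
  calc |x ⬝ᵥ y| ≤ ∑ i, |x i * y i| := Finset.abs_sum_le_sum_abs _ _
    _ ≤ ∑ _i : Fin d, ‖x‖ * ‖y‖ := by
        refine Finset.sum_le_sum fun i _ => ?_
        rw [abs_mul]
        exact mul_le_mul (norm_le_pi_norm x i) (norm_le_pi_norm y i) (abs_nonneg _) (norm_nonneg _)
    _ = d * ‖x‖ * ‖y‖ := by simp [mul_assoc]

lemma norm_dotCLM_le (y : Vec d) : ‖dotCLM y‖ ≤ d * ‖y‖ :=
  ContinuousLinearMap.opNorm_le_bound _ (by positivity) fun δ => by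
    simpa using abs_dotProduct_le y δ

lemma continuous_exp_dotProduct (θ : Vec d) : Continuous fun y : Vec d => Real.exp (θ ⬝ᵥ y) := by
  unfold dotProduct
  fun_prop

/-- Exponentials of the (supremum) norm are controlled by exponentials of the coordinates. -/
lemma exp_norm_le {r : ℝ} (hr : 0 < r) (y : Vec d) :
    Real.exp (r * ‖y‖) ≤ 1 + ∑ i, (Real.exp (r * y i) + Real.exp (-r * y i)) := by
  have hpos : 0 ≤ ∑ i, (Real.exp (r * y i) + Real.exp (-r * y i)) :=
    Finset.sum_nonneg fun i _ => by positivity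
  have hM : ‖y‖ ≤ Real.log (1 + ∑ i, (Real.exp (r * y i) + Real.exp (-r * y i))) / r := by
    refine (pi_norm_le_iff_of_nonneg (div_nonneg (Real.log_nonneg (by linarith)) hr.le)).2
      fun i => ?_
    rw [le_div_iff₀ hr, Real.le_log_iff_exp_le (by positivity)]
    have h1 : Real.exp (r * y i) + Real.exp (-r * y i)
        ≤ ∑ i, (Real.exp (r * y i) + Real.exp (-r * y i)) :=
      Finset.single_le_sum (f := fun i => Real.exp (r * y i) + Real.exp (-r * y i))
        (fun i _ => by positivity) (Finset.mem_univ i)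
    have h2 := Real.exp_pos (r * y i)
    have h3 := Real.exp_pos (-r * y i)
    rw [Real.norm_eq_abs]
    rcases abs_cases (y i) with ⟨h, _⟩ | ⟨h, _⟩
    · rw [h, mul_comm]; linarith
    · rw [h, show -y i * r = -r * y i by ring]; linarith
  rw [le_div_iff₀ hr, Real.le_log_iff_exp_le (by positivity)] at hM
  rwa [mul_comm]

lemma HasExpMoments.integrable_exp_norm {ν : Measure (Vec d)} (h : HasExpMoments ν) {r : ℝ}
    (hr : 0 < r) (θ : Vec d) :
    Integrable (fun y => Real.exp (r * ‖y‖) * Real.exp (θ ⬝ᵥ y)) ν := by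
  have key : Integrable (fun y => (1 + ∑ i, (Real.exp (r * y i) + Real.exp (-r * y i))) *
      Real.exp (θ ⬝ᵥ y)) ν := by
    have e : ∀ (s : ℝ) (i : Fin d) (y : Vec d), Real.exp (s * y i) * Real.exp (θ ⬝ᵥ y)
        = Real.exp ((θ + Pi.single i s) ⬝ᵥ y) := by
      intro s i y
      rw [← Real.exp_add, add_dotProduct, single_dotProduct, add_comm]
    simp only [add_mul, one_mul, Finset.sum_mul, e]
    exact (h θ).add (integrable_finsetSum _ fun i _ => (h _).add (h _))
  refine key.mono' ?_ (Filter.Eventually.of_forall fun y => ?_)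
  · exact ((by fun_prop : Continuous fun y : Vec d => Real.exp (r * ‖y‖)).mul
      (continuous_exp_dotProduct θ)).aestronglyMeasurable
  · rw [Real.norm_of_nonneg (by positivity)]
    exact mul_le_mul_of_nonneg_right (exp_norm_le hr y) (Real.exp_pos _).le

lemma HasExpMoments.integrable_mul_exp {ν : Measure (Vec d)} (h : HasExpMoments ν) {E : Type*}
    [NormedAddCommGroup E] [NormedSpace ℝ E] [SecondCountableTopologyEither (Vec d) E] {P : Vec d → E}
    (hP : Continuous P) {C r : ℝ} (hr : 0 < r) (hPC : ∀ y, ‖P y‖ ≤ C * Real.exp (r * ‖y‖))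
    (θ : Vec d) : Integrable (fun y => Real.exp (θ ⬝ᵥ y) • P y) ν := by
  refine ((h.integrable_exp_norm hr θ).const_mul C).mono' ?_ (Filter.Eventually.of_forall fun y => ?_)
  · exact ((continuous_exp_dotProduct θ).smul hP).aestronglyMeasurable
  · rw [norm_smul, Real.norm_of_nonneg (Real.exp_pos _).le, mul_comm, ← mul_assoc]
    exact mul_le_mul_of_nonneg_right (hPC y) (Real.exp_pos _).le

/-- Differentiation under the integral sign for integrals against exponentials. -/
lemma HasExpMoments.hasFDerivAt_integral {ν : Measure (Vec d)} (h : HasExpMoments ν)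
    {P : Vec d → ℝ} (hP : Continuous P) (hPC : ∀ y, ‖P y‖ ≤ Real.exp (‖y‖)) (θ : Vec d) :
    HasFDerivAt (fun θ => ∫ y, Real.exp (θ ⬝ᵥ y) • P y ∂ν)
      (∫ y, Real.exp (θ ⬝ᵥ y) • (P y • dotCLM y) ∂ν) θ := by
  have hPC' : ∀ y, ‖P y‖ ≤ 1 * Real.exp (1 * ‖y‖) := by simpa using hPC
  have hbound : Integrable (fun y => Real.exp (θ ⬝ᵥ y) * (d * Real.exp ((d + 2) * ‖y‖))) ν := by
    convert (h.integrable_exp_norm (r := d + 2) (by positivity) θ).const_mul (d : ℝ) using 2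
    ring
  refine hasFDerivAt_integral_of_dominated_of_fderiv_le
    (F' := fun θ y => Real.exp (θ ⬝ᵥ y) • (P y • dotCLM y))
    (bound := fun y => Real.exp (θ ⬝ᵥ y) * (d * Real.exp ((d + 2) * ‖y‖)))
    (Metric.ball_mem_nhds θ one_pos) (Filter.Eventually.of_forall fun θ' => ?_)
    (h.integrable_mul_exp hP one_pos hPC' θ) ?_ (Filter.Eventually.of_forall fun y θ' hθ' => ?_)
    hbound (Filter.Eventually.of_forall fun y θ' _ => ?_)
  · exact ((continuous_exp_dotProduct θ').smul hP).aestronglyMeasurable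
  · exact ((continuous_exp_dotProduct θ).smul (hP.smul continuous_dotCLM)).aestronglyMeasurable
  · rw [norm_smul, norm_smul, Real.norm_of_nonneg (Real.exp_pos _).le]
    have h1 : Real.exp (θ' ⬝ᵥ y) ≤ Real.exp (θ ⬝ᵥ y) * Real.exp (d * ‖y‖) := by
      rw [← Real.exp_add, Real.exp_le_exp]
      have e : θ' ⬝ᵥ y = θ ⬝ᵥ y + (θ' - θ) ⬝ᵥ y := by rw [sub_dotProduct]; ring
      rw [e]
      have h2 := (le_abs_self _).trans (abs_dotProduct_le (θ' - θ) y)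
      have h3 : ‖θ' - θ‖ ≤ 1 := by
        rw [← dist_eq_norm]; exact (Metric.mem_ball.1 hθ').le
      have h4 : (d : ℝ) * ‖θ' - θ‖ * ‖y‖ ≤ d * 1 * ‖y‖ := by gcongr
      linarith
    have h2 : ‖P y‖ * ‖dotCLM y‖ ≤ Real.exp ‖y‖ * (d * Real.exp ‖y‖) := by
      have : ‖y‖ ≤ Real.exp ‖y‖ := by linarith [Real.add_one_le_exp ‖y‖]
      refine mul_le_mul (hPC y) ((norm_dotCLM_le y).trans ?_) (norm_nonneg _) (Real.exp_pos _).le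
      gcongr
    refine (mul_le_mul h1 h2 (by positivity) (by positivity)).trans_eq ?_
    have : Real.exp ((d + 2) * ‖y‖) = Real.exp (d * ‖y‖) * Real.exp ‖y‖ * Real.exp ‖y‖ := by
      rw [← Real.exp_add, ← Real.exp_add]; ring_nf
    rw [this]; ring
  · have h1 : HasFDerivAt (fun θ : Vec d => θ ⬝ᵥ y) (dotCLM y) θ' := by
      have := (dotCLM y).hasFDerivAt (x := θ')
      refine this.congr_of_eventuallyEq (Filter.Eventually.of_forall fun z => ?_)
      simp [dotProduct_comm]
    exact (h1.exp.mul_const (P y)).congr_fderiv (smul_comm _ _ _)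

lemma HasExpMoments.laplace_pos {ν : Measure (Vec d)} [NeZero ν] (h : HasExpMoments ν)
    (θ : Vec d) : 0 < laplace ν θ := integral_exp_pos (h θ)

lemma HasExpMoments.isProbabilityMeasure_expTilt {ν : Measure (Vec d)} [NeZero ν]
    (h : HasExpMoments ν) (θ : Vec d) : IsProbabilityMeasure (expTilt ν θ) :=
  isProbabilityMeasure_tilted (h θ)

lemma integral_expTilt {ν : Measure (Vec d)} {E : Type*} [NormedAddCommGroup E] [NormedSpace ℝ E]
    (θ : Vec d) (f : Vec d → E) :
    ∫ y, f y ∂(expTilt ν θ) = (laplace ν θ)⁻¹ • ∫ y, Real.exp (θ ⬝ᵥ y) • f y ∂ν := by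
  rw [expTilt, integral_tilted, ← integral_smul]
  refine integral_congr_ae (Filter.Eventually.of_forall fun y => ?_)
  simp only [smul_smul, laplace, div_eq_inv_mul]

lemma HasExpMoments.integrable_expTilt {ν : Measure (Vec d)} (h : HasExpMoments ν) {P : Vec d → ℝ}
    (hP : Continuous P) {C r : ℝ} (hr : 0 < r) (hPC : ∀ y, ‖P y‖ ≤ C * Real.exp (r * ‖y‖))
    (θ : Vec d) : Integrable P (expTilt ν θ) := by
  rw [expTilt, integrable_tilted_iff (h θ)]
  exact h.integrable_mul_exp hP hr hPC θ

lemma HasExpMoments.memLp_two_expTilt {ν : Measure (Vec d)} (h : HasExpMoments ν) (θ : Vec d) :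
    MemLp (fun y : Vec d => y) 2 (expTilt ν θ) := by
  refine (memLp_two_iff_integrable_sq_norm (f := fun y : Vec d => y) (by fun_prop)).2 ?_
  refine h.integrable_expTilt (by fun_prop) (C := 2) one_pos (fun y => ?_) θ
  have := Real.quadratic_le_exp_of_nonneg (norm_nonneg y)
  rw [Real.norm_of_nonneg (by positivity), one_mul]
  linarith [norm_nonneg y]

lemma norm_apply_le_exp (i : Fin d) (y : Vec d) : ‖y i‖ ≤ Real.exp ‖y‖ :=
  (norm_le_pi_norm y i).trans (by linarith [Real.add_one_le_exp ‖y‖])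

lemma integrable_apply_mul_apply {π : Measure (Vec d)}
    (hπ : MemLp (fun y : Vec d => y) 2 π) (i j : Fin d) : Integrable (fun y => y i * y j) π :=
  MemLp.integrable_mul (hπ.eval i) (hπ.eval j)

lemma integrable_apply {π : Measure (Vec d)} [IsFiniteMeasure π]
    (hπ : MemLp (fun y : Vec d => y) 2 π) (i : Fin d) : Integrable (fun y => y i) π :=
  (hπ.eval i).integrable one_le_two

lemma integral_eval {π : Measure (Vec d)} [IsFiniteMeasure π]
    (hπ : MemLp (fun y : Vec d => y) 2 π) (j : Fin d) : (∫ y, y ∂π) j = ∫ y, y j ∂π :=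
  ((ContinuousLinearMap.proj (R := ℝ) (φ := fun _ : Fin d => ℝ) j).integral_comp_comm
    (hπ.integrable one_le_two)).symm

lemma covMat_apply {π : Measure (Vec d)} [IsProbabilityMeasure π]
    (hπ : MemLp (fun y : Vec d => y) 2 π) (i j : Fin d) :
    covMat π i j = ∫ y, y i * y j ∂π - (∫ y, y i ∂π) * ∫ y, y j ∂π := by
  have h1 := (integrable_apply_mul_apply hπ i j).comp_fst π
  have h2 := (integrable_apply_mul_apply hπ i j).comp_snd π
  have h3 := (integrable_apply hπ i).mul_prod (integrable_apply hπ j)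
  have h4 := (integrable_apply hπ j).mul_prod (integrable_apply hπ i)
  have e : ∀ p : Vec d × Vec d, (p.1 i - p.2 i) * (p.1 j - p.2 j)
      = (p.1 i * p.1 j + p.2 i * p.2 j) - (p.1 i * p.2 j + p.1 j * p.2 i) := fun p => by ring
  simp only [covMat, Matrix.of_apply, e]
  have h12 : Integrable (fun p : Vec d × Vec d => p.1 i * p.1 j + p.2 i * p.2 j) (π.prod π) :=
    h1.add h2
  have h34 : Integrable (fun p : Vec d × Vec d => p.1 i * p.2 j + p.1 j * p.2 i) (π.prod π) :=
    h3.add h4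
  rw [integral_sub h12 h34, integral_add h1 h2, integral_add h3 h4,
    integral_fun_fst (f := fun y : Vec d => y i * y j),
    integral_fun_snd (f := fun y : Vec d => y i * y j),
    integral_prod_mul (fun y : Vec d => y i) (fun y : Vec d => y j),
    integral_prod_mul (fun y : Vec d => y j) (fun y : Vec d => y i)]
  simp
  ring

lemma covMat_symm (π : Measure (Vec d)) (i j : Fin d) : covMat π i j = covMat π j i := by
  simp only [covMat, Matrix.of_apply, mul_comm]

lemma HasExpMoments.hasFDerivAt_laplace {ν : Measure (Vec d)} (h : HasExpMoments ν) (θ : Vec d) :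
    HasFDerivAt (laplace ν) (∫ y, Real.exp (θ ⬝ᵥ y) • ((1 : ℝ) • dotCLM y) ∂ν) θ := by
  have := h.hasFDerivAt_integral (P := fun _ => 1) continuous_const (fun y => by simp) θ
  simp only [smul_eq_mul, mul_one] at this
  exact this

/-- The Fréchet derivative of the mean of an exponential family is the covariance matrix. -/
lemma HasExpMoments.hasFDerivAt_mean {ν : Measure (Vec d)} [NeZero ν] (h : HasExpMoments ν)
    (θ : Vec d) :
    HasFDerivAt (fun θ => ∫ y, y ∂(expTilt ν θ))
      (covMat (expTilt ν θ)).mulVecLin.toContinuousLinearMap θ := by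
  have hp : ∀ θ, IsProbabilityMeasure (expTilt ν θ) := h.isProbabilityMeasure_expTilt
  have hL := h.hasFDerivAt_laplace θ
  have hLθ := (h.laplace_pos θ).ne'
  have hdot : ∀ y : Vec d, ‖dotCLM y‖ ≤ d * Real.exp (1 * ‖y‖) := by
    intro y
    refine (norm_dotCLM_le y).trans ?_
    rw [one_mul]
    gcongr
    linarith [Real.add_one_le_exp ‖y‖]
  have hint : ∀ P : Vec d → ℝ, Continuous P → (∀ y, ‖P y‖ ≤ Real.exp ‖y‖) →
      Integrable (fun y => Real.exp (θ ⬝ᵥ y) • (P y • dotCLM y)) ν := by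
    intro P hP hPC
    refine h.integrable_mul_exp (P := fun y => P y • dotCLM y)
      (hP.smul continuous_dotCLM) (C := d) (r := 2) two_pos
      (fun y => ?_) θ
    rw [norm_smul]
    refine (mul_le_mul (hPC y) (hdot y) (norm_nonneg _) (Real.exp_pos _).le).trans_eq ?_
    rw [one_mul, two_mul, Real.exp_add]
    ring
  rw [hasFDerivAt_pi']
  intro j
  have hN := h.hasFDerivAt_integral (P := fun y => y j) (by fun_prop) (norm_apply_le_exp j) θ
  have hinv := (hasDerivAt_inv hLθ).comp_hasFDerivAt θ hL
  have hmul := hinv.mul hN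
  have e0 : (fun θ => (∫ y, y ∂(expTilt ν θ)) j)
      = (Inv.inv ∘ laplace ν) * fun θ => ∫ y, Real.exp (θ ⬝ᵥ y) • y j ∂ν := by
    funext θ
    rw [integral_eval (h.memLp_two_expTilt θ), integral_expTilt]
    rfl
  rw [e0]
  refine hmul.congr_fderiv ?_
  have hm := h.memLp_two_expTilt θ
  have e1 : ∀ P : Vec d → ℝ, Continuous P → (∀ y, ‖P y‖ ≤ Real.exp ‖y‖) → ∀ i,
      (∫ y, Real.exp (θ ⬝ᵥ y) • (P y • dotCLM y) ∂ν) (Pi.single i 1)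
        = laplace ν θ * ∫ y, P y * y i ∂(expTilt ν θ) := by
    intro P hP hPC i
    rw [ContinuousLinearMap.integral_apply (hint P hP hPC), integral_expTilt, smul_eq_mul,
      ← mul_assoc, mul_inv_cancel₀ hLθ, one_mul]
    simp
  have e2 : ∫ y, Real.exp (θ ⬝ᵥ y) • y j ∂ν = laplace ν θ * ∫ y, y j ∂(expTilt ν θ) := by
    rw [integral_expTilt, smul_eq_mul, ← mul_assoc, mul_inv_cancel₀ hLθ, one_mul]
  refine ContinuousLinearMap.coe_injective (LinearMap.pi_ext' fun i => LinearMap.ext_ring ?_)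
  have l1 := e1 (fun _ => 1) continuous_const (fun y => by simp) i
  have l2 := e1 (fun y => y j) (by fun_prop) (norm_apply_le_exp j) i
  simp only [one_mul] at l1
  simp only [LinearMap.comp_apply, LinearMap.single_apply, ContinuousLinearMap.coe_coe,
    _root_.add_apply, _root_.smul_apply, ContinuousLinearMap.comp_apply,
    LinearMap.coe_toContinuousLinearMap', Matrix.mulVecLin_apply, ContinuousLinearMap.proj_apply,
    Matrix.mulVec_single_one, l1, l2, smul_eq_mul, Function.comp_apply, Matrix.col_apply]
  rw [covMat_apply hm]
  simp only [smul_eq_mul] at e2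
  rw [e2]
  field_simp
  ring

/-- The gradient of the log-Laplace transform is the mean of the tilted measure. -/
lemma HasExpMoments.hasFDerivAt_log_laplace {ν : Measure (Vec d)} [NeZero ν] (h : HasExpMoments ν)
    (θ : Vec d) :
    HasFDerivAt (fun θ => Real.log (laplace ν θ)) (dotCLM (∫ y, y ∂(expTilt ν θ))) θ := by
  have hL := h.hasFDerivAt_laplace θ
  have hp := h.isProbabilityMeasure_expTilt θ
  refine (hL.log (h.laplace_pos θ).ne').congr_fderiv ?_
  refine ContinuousLinearMap.coe_injective (LinearMap.pi_ext' fun i => LinearMap.ext_ring ?_)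
  have hint : Integrable (fun y => Real.exp (θ ⬝ᵥ y) • ((1 : ℝ) • dotCLM y)) ν := by
    refine h.integrable_mul_exp (P := fun y => (1 : ℝ) • dotCLM y)
      (by simpa using continuous_dotCLM) (C := d) one_pos
      (fun y => ?_) θ
    rw [one_smul, one_mul]
    refine (norm_dotCLM_le y).trans ?_
    gcongr
    linarith [Real.add_one_le_exp ‖y‖]
  simp only [LinearMap.comp_apply, LinearMap.single_apply, ContinuousLinearMap.coe_coe,
    _root_.smul_apply, dotCLM_apply, dotProduct_single_one,
    ContinuousLinearMap.integral_apply hint]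
  rw [integral_eval (h.memLp_two_expTilt θ), integral_expTilt]
  simp

/-! ### Quadratic forms and the Loewner order -/

/-- The quadratic form `x' A x`. -/
def quad (A : Mat d) (x : Vec d) : ℝ := x ⬝ᵥ (A *ᵥ x)

lemma quad_le_of_le {A B : Mat d} (h : A ≤ B) (x : Vec d) : quad A x ≤ quad B x := by
  have := (Matrix.le_iff.1 h).dotProduct_mulVec_nonneg x
  simp only [star_trivial, sub_mulVec, dotProduct_sub] at this
  exact sub_nonneg.1 this

lemma le_of_quad_le {A B : Mat d} (hA : A.IsHermitian) (hB : B.IsHermitian)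
    (h : ∀ x, quad A x ≤ quad B x) : A ≤ B := by
  refine Matrix.le_iff.2 (PosSemidef.of_dotProduct_mulVec_nonneg (hB.sub hA) fun x => ?_)
  simp only [star_trivial, sub_mulVec, dotProduct_sub]
  exact sub_nonneg.2 (h x)

lemma quad_add (A B : Mat d) (x : Vec d) : quad (A + B) x = quad A x + quad B x := by
  simp [quad, add_mulVec, dotProduct_add]

lemma quad_smul (A : Mat d) (t : ℝ) (x : Vec d) : quad A (t • x) = t ^ 2 * quad A x := by
  simp [quad, mulVec_smul]
  ring

lemma quad_conj (A M : Mat d) (x : Vec d) : quad (Mᵀ * A * M) x = quad A (M *ᵥ x) := by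
  simp only [quad]
  rw [← mulVec_mulVec, ← mulVec_mulVec, dotProduct_mulVec, vecMul_transpose]

lemma quad_nonneg {A : Mat d} (hA : A.PosSemidef) (x : Vec d) : 0 ≤ quad A x := by
  simpa [quad] using hA.dotProduct_mulVec_nonneg x

lemma transpose_eq_of_isHermitian {A : Mat d} (hA : A.IsHermitian) : Aᵀ = A := by
  rw [← conjTranspose_eq_transpose_of_trivial]
  exact hA

lemma dotProduct_mulVec_comm {A : Mat d} (hA : A.IsHermitian) (x y : Vec d) :
    x ⬝ᵥ (A *ᵥ y) = y ⬝ᵥ (A *ᵥ x) := by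
  rw [dotProduct_mulVec, ← mulVec_transpose, transpose_eq_of_isHermitian hA, dotProduct_comm]

lemma quad_inv {A : Mat d} (hA : A.PosDef) (x : Vec d) :
    quad A (A⁻¹ *ᵥ x) = quad A⁻¹ x := by
  have hdet : IsUnit A.det := (Matrix.isUnit_iff_isUnit_det _).mp hA.isUnit
  simp only [quad]
  rw [mulVec_mulVec, Matrix.mul_nonsing_inv _ hdet, one_mulVec, dotProduct_comm]

/-- Young's inequality for the quadratic form of `A` and that of its inverse. -/
lemma two_mul_dotProduct_le {A : Mat d} (hA : A.PosDef) (x y : Vec d) :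
    2 * (x ⬝ᵥ y) ≤ quad A y + quad A⁻¹ x := by
  have hdet : IsUnit A.det := (Matrix.isUnit_iff_isUnit_det _).mp hA.isUnit
  have h0 := quad_nonneg hA.posSemidef (y - A⁻¹ *ᵥ x)
  have h1 : A *ᵥ (A⁻¹ *ᵥ x) = x := by
    rw [mulVec_mulVec, Matrix.mul_nonsing_inv _ hdet, one_mulVec]
  have h2 : quad A (y - A⁻¹ *ᵥ x) = quad A y - 2 * (x ⬝ᵥ y) + quad A⁻¹ x := by
    simp only [quad, mulVec_sub, sub_dotProduct, dotProduct_sub, h1]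
    rw [dotProduct_mulVec_comm hA.isHermitian (A⁻¹ *ᵥ x) y, h1, dotProduct_comm y x,
      dotProduct_comm (A⁻¹ *ᵥ x) x]
    ring
  linarith

/-- Comparison of two functions of `s` that agree at `0`, to first order as `s → 0`. -/
lemma le_of_forall_one_add_mul_le_exp {a b : ℝ}
    (h : ∀ s : ℝ, 0 < s → 1 + s * a ≤ Real.exp (s * b)) : a ≤ b := by
  have hd : HasDerivAt (fun s : ℝ => Real.exp (s * b)) b 0 := by
    have := ((hasDerivAt_id (0 : ℝ)).mul_const b).exp
    simpa using this
  refine ge_of_tendsto hd.tendsto_slope_zero_right ?_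
  filter_upwards [self_mem_nhdsWithin] with s hs
  have hs : 0 < s := hs
  simp only [zero_add, zero_mul, Real.exp_zero, smul_eq_mul]
  rw [← div_eq_inv_mul, le_div_iff₀ hs]
  linarith [h s hs]

/-! ### Variance and covariance -/

lemma memLp_dotProduct {π : Measure (Vec d)} (hπ : MemLp (fun y : Vec d => y) 2 π) (l : Vec d) :
    MemLp (fun y => l ⬝ᵥ y) 2 π := by
  simp only [dotProduct]
  exact memLp_finsetSum _ fun i _ => (hπ.eval i).const_mul (l i)

lemma covMat_isHermitian (π : Measure (Vec d)) : (covMat π).IsHermitian := by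
  ext i j
  simpa using covMat_symm π j i

/-- The quadratic form of the covariance matrix gives the variances of the linear forms. -/
lemma quad_covMat {π : Measure (Vec d)} [IsProbabilityMeasure π]
    (hπ : MemLp (fun y : Vec d => y) 2 π) (l : Vec d) :
    quad (covMat π) l = ∫ y, (l ⬝ᵥ y) ^ 2 ∂π - (∫ y, l ⬝ᵥ y ∂π) ^ 2 := by
  have h1 : ∫ y, (l ⬝ᵥ y) ^ 2 ∂π = ∑ i, ∑ j, l i * l j * ∫ y, y i * y j ∂π := by
    have : ∀ y : Vec d, (l ⬝ᵥ y) ^ 2 = ∑ i, ∑ j, l i * l j * (y i * y j) := by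
      intro y
      rw [sq, dotProduct, Finset.sum_mul_sum]
      exact Finset.sum_congr rfl fun i _ => Finset.sum_congr rfl fun j _ => by ring
    simp only [this]
    rw [integral_finsetSum _ fun i _ => integrable_finsetSum _ fun j _ =>
      (integrable_apply_mul_apply hπ i j).const_mul _]
    refine Finset.sum_congr rfl fun i _ => ?_
    rw [integral_finsetSum _ fun j _ => (integrable_apply_mul_apply hπ i j).const_mul _]
    exact Finset.sum_congr rfl fun j _ => integral_const_mul _ _
  have h2 : ∫ y, l ⬝ᵥ y ∂π = ∑ i, l i * ∫ y, y i ∂π := by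
    simp only [dotProduct]
    rw [integral_finsetSum _ fun i _ => (integrable_apply hπ i).const_mul _]
    exact Finset.sum_congr rfl fun j _ => integral_const_mul _ _
  rw [h1, h2, sq, Finset.sum_mul_sum, ← Finset.sum_sub_distrib]
  simp only [quad, dotProduct, mulVec, Finset.mul_sum, covMat_apply hπ]
  refine Finset.sum_congr rfl fun i _ => ?_
  rw [← Finset.sum_sub_distrib]
  exact Finset.sum_congr rfl fun j _ => by ring

lemma covMat_posSemidef {π : Measure (Vec d)} [IsProbabilityMeasure π]
    (hπ : MemLp (fun y : Vec d => y) 2 π) : (covMat π).PosSemidef := by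
  refine PosSemidef.of_dotProduct_mulVec_nonneg (covMat_isHermitian π) fun l => ?_
  have h := quad_covMat hπ l
  have hv := variance_nonneg (fun y => l ⬝ᵥ y) π
  rw [variance_eq_sub (memLp_dotProduct hπ l)] at hv
  simp only [star_trivial]
  rw [quad] at h
  rw [h]
  exact hv

/-! ### Gibbs measures -/

lemma measurable_ofReal_exp_neg {q : Vec d → ℝ} (hq : Measurable q) :
    Measurable fun y => ENNReal.ofReal (Real.exp (-q y)) := by fun_prop

lemma integral_gibbs {q : Vec d → ℝ} (hq : Measurable q) (f : Vec d → ℝ) :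
    ∫ y, f y ∂(gibbs q) = ∫ y, Real.exp (-q y) * f y := by
  rw [gibbs, integral_withDensity_eq_integral_toReal_smul (measurable_ofReal_exp_neg hq) (by simp)]
  simp [ENNReal.toReal_ofReal (Real.exp_pos _).le]

lemma integrable_gibbs_iff {q : Vec d → ℝ} (hq : Measurable q) (f : Vec d → ℝ) :
    Integrable f (gibbs q) ↔ Integrable fun y => Real.exp (-q y) * f y := by
  rw [gibbs, integrable_withDensity_iff_integrable_smul' (measurable_ofReal_exp_neg hq) (by simp)]
  simp [ENNReal.toReal_ofReal (Real.exp_pos _).le]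

lemma gibbs_neZero {q : Vec d → ℝ} (hq : Measurable q) : NeZero (gibbs q) := by
  refine ⟨fun h => ?_⟩
  rw [gibbs, withDensity_eq_zero_iff (measurable_ofReal_exp_neg hq).aemeasurable] at h
  have : ∀ᵐ y : Vec d, False := by
    filter_upwards [h] with y hy
    simp only [Pi.zero_apply, ENNReal.ofReal_eq_zero] at hy
    exact absurd (Real.exp_pos _) (not_lt.2 hy)
  rw [Filter.eventually_false_iff_eq_bot, ae_eq_bot] at this
  exact NeZero.ne (volume : Measure (Vec d)) this

/-- Exponential tilting of a Gibbs measure only changes its potential by an affine function. -/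
lemma expTilt_gibbs {q : Vec d → ℝ} (hq : Measurable q) (h : HasExpMoments (gibbs q)) (θ : Vec d) :
    expTilt (gibbs q) θ = gibbs fun y => q y - θ ⬝ᵥ y + Real.log (laplace (gibbs q) θ) := by
  have := gibbs_neZero hq
  have hZ := h.laplace_pos θ
  have hm : Measurable fun y : Vec d =>
      ENNReal.ofReal (Real.exp (θ ⬝ᵥ y) / laplace (gibbs q) θ) :=
    ((continuous_exp_dotProduct θ).measurable.div_const _).ennreal_ofReal
  refine (withDensity_mul volume (measurable_ofReal_exp_neg hq) hm).symm.trans ?_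
  refine congrArg (volume.withDensity) (funext fun y => ?_)
  rw [Pi.mul_apply, ← ENNReal.ofReal_mul (Real.exp_pos _).le]
  congr 1
  rw [neg_add, Real.exp_add, Real.exp_neg (Real.log _), Real.exp_log hZ, neg_sub, sub_eq_add_neg,
    Real.exp_add]
  ring

lemma HasExpMoments.ofReal_laplace_gibbs {q : Vec d → ℝ} (hq : Measurable q)
    (h : HasExpMoments (gibbs q)) (θ : Vec d) :
    ENNReal.ofReal (laplace (gibbs q) θ) = ∫⁻ y, ENNReal.ofReal (Real.exp (θ ⬝ᵥ y - q y)) := by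
  rw [laplace, integral_gibbs hq, ofReal_integral_eq_lintegral_ofReal]
  · refine lintegral_congr fun y => ?_
    rw [← Real.exp_add, neg_add_eq_sub]
  · exact (integrable_gibbs_iff hq _).1 (h θ)
  · exact Filter.Eventually.of_forall fun y => by positivity

/-! ### The Brascamp–Lieb bound for linear functions -/

/-- A strongly log-concave measure has a strongly log-concave Laplace transform; this is the
Prékopa–Leindler inequality applied to exponential tilts. -/
lemma laplace_mul_laplace_le {q : Vec d → ℝ} (hq : Measurable q) (h : HasExpMoments (gibbs q))
    {A : Mat d} (hA : A.PosDef)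
    (hconv : ∀ y δ, quad A δ + 2 * q y ≤ q (y + δ) + q (y - δ)) (θ η : Vec d) :
    laplace (gibbs q) (θ + η) * laplace (gibbs q) (θ - η)
      ≤ laplace (gibbs q) θ ^ 2 * Real.exp (quad A⁻¹ η) := by
  have := gibbs_neZero hq
  have hm : ∀ θ : Vec d, Measurable fun y => ENNReal.ofReal (Real.exp (θ ⬝ᵥ y - q y)) := by
    intro θ
    have : Measurable fun y : Vec d => θ ⬝ᵥ y := by unfold dotProduct; fun_prop
    fun_prop
  have key := prekopa_leindler (hm (θ + η)) (hm (θ - η))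
    ((hm θ).const_mul (ENNReal.ofReal (Real.exp (quad A⁻¹ η / 2)))) (by
      intro x y
      rw [← ENNReal.ofReal_mul (Real.exp_pos _).le, ← ENNReal.ofReal_mul (Real.exp_pos _).le,
        ← ENNReal.ofReal_pow (by positivity), ← Real.exp_add, ← Real.exp_add, ← Real.exp_nat_mul]
      refine ENNReal.ofReal_le_ofReal (Real.exp_le_exp.2 ?_)
      set w : Vec d := (1 / 2 : ℝ) • (x + y) with hw
      set δ : Vec d := (1 / 2 : ℝ) • (x - y) with hδ
      have hx : x = w + δ := by rw [hw, hδ]; module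
      have hy : y = w - δ := by rw [hw, hδ]; module
      have h1 := hconv w δ
      have h2 := two_mul_dotProduct_le hA η δ
      rw [← hx, ← hy] at h1
      have h3 : (θ + η) ⬝ᵥ x + (θ - η) ⬝ᵥ y = 2 * (θ ⬝ᵥ w) + 2 * (η ⬝ᵥ δ) := by
        rw [hx, hy]
        simp only [add_dotProduct, sub_dotProduct, dotProduct_add, dotProduct_sub]
        ring
      push_cast
      linarith)
  rw [lintegral_const_mul _ (hm θ), ← h.ofReal_laplace_gibbs hq, ← h.ofReal_laplace_gibbs hq,
    ← h.ofReal_laplace_gibbs hq, ← ENNReal.ofReal_mul (h.laplace_pos _).le,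
    ← ENNReal.ofReal_mul (Real.exp_pos _).le, ← ENNReal.ofReal_pow
      (mul_nonneg (Real.exp_pos _).le (h.laplace_pos _).le),
    ENNReal.ofReal_le_ofReal_iff (by positivity)] at key
  refine key.trans_eq ?_
  rw [mul_pow, ← Real.exp_nat_mul]
  push_cast
  ring_nf

lemma two_add_sq_le_exp_add_exp_neg (s : ℝ) : 2 + s ^ 2 ≤ Real.exp s + Real.exp (-s) := by
  have h1 : Real.exp s + Real.exp (-s) = 2 * Real.cosh s := by rw [Real.cosh_eq]; ring
  have h2 : Real.cosh s = 1 + 2 * Real.sinh (s / 2) ^ 2 := by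
    have := Real.cosh_two_mul (s / 2)
    rw [Real.cosh_sq, mul_div_cancel₀ _ two_ne_zero] at this
    rw [this]; ring
  have h3 : (s / 2) ^ 2 ≤ Real.sinh (s / 2) ^ 2 := by
    rcases le_total 0 (s / 2) with h | h
    · exact pow_le_pow_left₀ h (Real.self_le_sinh_iff.2 h) 2
    · have := Real.sinh_le_self_iff.2 h
      nlinarith
  rw [h1, h2]
  nlinarith

/-- With independent copies `Y`, `Z` of law `expTilt ν θ`, the left side is `E[exp (η · (Y - Z))]`,
which is `E[cosh (η · (Y - Z))]` by symmetry. -/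
lemma HasExpMoments.one_add_quad_covMat_le {ν : Measure (Vec d)} [NeZero ν] (h : HasExpMoments ν)
    (θ η : Vec d) :
    laplace ν θ ^ 2 * (1 + quad (covMat (expTilt ν θ)) η)
      ≤ laplace ν (θ + η) * laplace ν (θ - η) := by
  set π := expTilt ν θ with hπ
  have : IsProbabilityMeasure π := h.isProbabilityMeasure_expTilt θ
  have hZ := h.laplace_pos θ
  have hm : MemLp (fun y : Vec d => y) 2 π := h.memLp_two_expTilt θ
  have hE : ∀ η : Vec d, laplace ν (θ + η) = laplace ν θ * ∫ y, Real.exp (η ⬝ᵥ y) ∂π := by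
    intro η
    rw [hπ, integral_expTilt, smul_eq_mul, ← mul_assoc, mul_inv_cancel₀ hZ.ne', one_mul, laplace]
    refine integral_congr_ae (Filter.Eventually.of_forall fun y => ?_)
    simp only [add_dotProduct, Real.exp_add, smul_eq_mul]
  have hI : ∀ η : Vec d, Integrable (fun y => Real.exp (η ⬝ᵥ y)) π := by
    intro η
    rw [hπ, expTilt, integrable_tilted_iff (h θ)]
    simpa only [add_dotProduct, Real.exp_add, smul_eq_mul] using h (θ + η)
  have hneg : ∀ y : Vec d, (-η) ⬝ᵥ y = -(η ⬝ᵥ y) := fun y => neg_dotProduct _ _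
  have hdot := memLp_dotProduct hm η
  have i1 := (hdot.integrable_sq).comp_fst π
  have i2 := (hdot.integrable_sq).comp_snd π
  have i3 := (hdot.integrable one_le_two).mul_prod (hdot.integrable one_le_two)
  have i12 : Integrable (fun p : Vec d × Vec d => (η ⬝ᵥ p.1) ^ 2 + (η ⬝ᵥ p.2) ^ 2) (π.prod π) :=
    i1.add i2
  have i123 : Integrable (fun p : Vec d × Vec d => (η ⬝ᵥ p.1) ^ 2 + (η ⬝ᵥ p.2) ^ 2
      - 2 * ((η ⬝ᵥ p.1) * (η ⬝ᵥ p.2))) (π.prod π) := i12.sub (i3.const_mul 2)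
  have j1 := (hI η).mul_prod (hI (-η))
  have j2 := (hI (-η)).mul_prod (hI η)
  have hint : ∫ p : Vec d × Vec d, (2 + ((η ⬝ᵥ p.1) ^ 2 + (η ⬝ᵥ p.2) ^ 2
        - 2 * ((η ⬝ᵥ p.1) * (η ⬝ᵥ p.2)))) ∂(π.prod π)
      ≤ ∫ p : Vec d × Vec d, (Real.exp (η ⬝ᵥ p.1) * Real.exp ((-η) ⬝ᵥ p.2)
        + Real.exp ((-η) ⬝ᵥ p.1) * Real.exp (η ⬝ᵥ p.2)) ∂(π.prod π) := by
    refine integral_mono ((integrable_const _).add i123) (j1.add j2)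
      fun p => ?_
    have := two_add_sq_le_exp_add_exp_neg (η ⬝ᵥ p.1 - η ⬝ᵥ p.2)
    simp only [hneg, ← Real.exp_add]
    calc _ = 2 + (η ⬝ᵥ p.1 - η ⬝ᵥ p.2) ^ 2 := by ring
      _ ≤ _ := this
      _ = _ := by ring_nf
  rw [integral_add j1 j2, integral_prod_mul (fun y : Vec d => Real.exp (η ⬝ᵥ y))
      (fun y : Vec d => Real.exp ((-η) ⬝ᵥ y)),
    integral_prod_mul (fun y : Vec d => Real.exp ((-η) ⬝ᵥ y))
      (fun y : Vec d => Real.exp (η ⬝ᵥ y)),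
    integral_add (integrable_const _) i123,
    integral_sub i12 (i3.const_mul 2), integral_add i1 i2,
    integral_const_mul, integral_prod_mul (fun y : Vec d => η ⬝ᵥ y) (fun y : Vec d => η ⬝ᵥ y),
    integral_fun_fst (f := fun y : Vec d => (η ⬝ᵥ y) ^ 2),
    integral_fun_snd (f := fun y : Vec d => (η ⬝ᵥ y) ^ 2)] at hint
  simp only [integral_const, probReal_univ, smul_eq_mul, one_mul] at hint
  rw [sub_eq_add_neg θ η, hE, hE, quad_covMat hm]
  calc _ ≤ laplace ν θ ^ 2 * ((∫ y, Real.exp (η ⬝ᵥ y) ∂π) * ∫ y, Real.exp ((-η) ⬝ᵥ y) ∂π) := by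
        gcongr
        linarith
    _ = _ := by ring

/-- If `∇²q ≥ A` in the sense of second differences, then the tilts of `e^{-q}` have covariance at
most `A⁻¹`. -/
theorem covMat_expTilt_le {q : Vec d → ℝ} (hq : Measurable q) (h : HasExpMoments (gibbs q))
    {A : Mat d} (hA : A.PosDef)
    (hconv : ∀ y δ, quad A δ + 2 * q y ≤ q (y + δ) + q (y - δ)) (θ : Vec d) :
    covMat (expTilt (gibbs q) θ) ≤ A⁻¹ := by
  have := gibbs_neZero hq
  refine le_of_quad_le (covMat_isHermitian _) hA.inv.isHermitian fun l => ?_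
  refine le_of_forall_one_add_mul_le_exp fun s hs => ?_
  have hZ := h.laplace_pos θ
  have h1 := h.one_add_quad_covMat_le θ (√s • l)
  have h2 := laplace_mul_laplace_le hq h hA hconv θ (√s • l)
  rw [quad_smul, Real.sq_sqrt hs.le] at h1 h2
  exact le_of_mul_le_mul_left (h1.trans h2) (by positivity)

/-! ### The Cramér–Rao bound -/

/-- If `∇²q ≤ B` in the sense of second differences, then the tilts of `e^{-q}` have covariance at
least `B⁻¹`. The variance of `l · Y` is bounded below by testing against the ratio of the density
and its translate by `h` (the Chapman–Robbins inequality) and letting `h` shrink in the direction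
`B⁻¹ l`; no integration by parts is needed. -/
theorem inv_le_covMat_expTilt {q : Vec d → ℝ} (hq : Measurable q) (h : HasExpMoments (gibbs q))
    {B : Mat d} (hB : B.PosDef)
    (hconc : ∀ y δ, q (y + δ) + q (y - δ) ≤ quad B δ + 2 * q y) (θ : Vec d) :
    B⁻¹ ≤ covMat (expTilt (gibbs q) θ) := by
  have := gibbs_neZero hq
  have hP : IsProbabilityMeasure (expTilt (gibbs q) θ) := h.isProbabilityMeasure_expTilt θ
  have hm : MemLp (fun y : Vec d => y) 2 (expTilt (gibbs q) θ) := h.memLp_two_expTilt θ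
  rw [expTilt_gibbs hq h θ] at hP hm ⊢
  set Q : Vec d → ℝ := fun y => q y - θ ⬝ᵥ y + Real.log (laplace (gibbs q) θ) with hQdef
  have hQ : Measurable Q := by
    have : Measurable fun y : Vec d => θ ⬝ᵥ y := by unfold dotProduct; fun_prop
    fun_prop
  have hQc : ∀ y δ, Q (y + δ) + Q (y - δ) ≤ quad B δ + 2 * Q y := by
    intro y δ
    have := hconc y δ
    simp only [hQdef, dotProduct_add, dotProduct_sub]
    linarith
  clear_value Q
  have hρ : Integrable fun y => Real.exp (-Q y) := by
    simpa using (integrable_gibbs_iff hQ (fun _ => 1)).1 (integrable_const _)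
  have hρ1 : ∫ y, Real.exp (-Q y) = 1 := by
    have := integral_gibbs hQ (fun _ => 1)
    simpa using this.symm
  refine le_of_quad_le hB.inv.isHermitian (covMat_isHermitian _) fun l => ?_
  set V := quad (covMat (gibbs Q)) l with hV
  set b := quad B⁻¹ l with hb
  suffices hs : ∀ s : ℝ, 0 < s → 1 + s * (2 * b - V) ≤ Real.exp (s * b) by
    linarith [le_of_forall_one_add_mul_le_exp hs]
  intro s hs
  set t := √s with ht
  have ht0 : 0 < t := Real.sqrt_pos.2 hs
  have hts : t ^ 2 = s := Real.sq_sqrt hs.le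
  set k : Vec d := t • (B⁻¹ *ᵥ l) with hk
  have hBk : quad B k = s * b := by rw [hk, quad_smul, quad_inv hB, hts]
  have hlk : l ⬝ᵥ k = t * b := by rw [hk, dotProduct_smul, smul_eq_mul, hb, quad]
  set m := ∫ y, l ⬝ᵥ y ∂(gibbs Q) with hm_def
  have hdot := memLp_dotProduct hm l
  have ha : MemLp (fun y => l ⬝ᵥ y - m) 2 (gibbs Q) := hdot.sub (memLp_const m)
  have ha0 : ∫ y, (l ⬝ᵥ y - m) ∂(gibbs Q) = 0 := by
    rw [integral_sub (hdot.integrable one_le_two) (integrable_const _)]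
    simp [hm_def]
  have ha2 : ∫ y, (l ⬝ᵥ y - m) ^ 2 ∂(gibbs Q) = V := by
    have e : ∀ y : Vec d, (l ⬝ᵥ y - m) ^ 2 = (l ⬝ᵥ y) ^ 2 - (2 * m) * (l ⬝ᵥ y) + m ^ 2 :=
      fun y => by ring
    have i1 := hdot.integrable_sq
    have i2 := (hdot.integrable one_le_two).const_mul (2 * m)
    have i3 : Integrable (fun y => (l ⬝ᵥ y) ^ 2 - (2 * m) * (l ⬝ᵥ y)) (gibbs Q) := i1.sub i2
    simp only [e]
    rw [integral_add i3 (integrable_const _), integral_sub i1 i2, integral_const_mul,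
      hV, quad_covMat hm]
    simp only [integral_const, probReal_univ, smul_eq_mul, one_mul, ← hm_def]
    ring
  -- the likelihood ratio of the law translated by `-k`
  set R : Vec d → ℝ := fun y => Real.exp (Q y - Q (y + k)) with hR
  have hRm : Measurable R := by fun_prop
  have hR1i : Integrable R (gibbs Q) := by
    rw [integrable_gibbs_iff hQ]
    refine (hρ.comp_add_right k).congr (Filter.Eventually.of_forall fun y => ?_)
    simp only [hR, ← Real.exp_add]
    ring_nf
  have hR1 : ∫ y, R y ∂(gibbs Q) = 1 := by
    rw [integral_gibbs hQ, ← hρ1, ← integral_add_right_eq_self (fun y => Real.exp (-Q y)) k]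
    refine integral_congr_ae (Filter.Eventually.of_forall fun y => ?_)
    simp only [hR, ← Real.exp_add]
    ring_nf
  have hR2le : ∀ y, Real.exp (-Q y) * R y ^ 2 ≤ Real.exp (s * b) * Real.exp (-Q (y + (k + k))) := by
    intro y
    simp only [hR]
    rw [← Real.exp_nat_mul, ← Real.exp_add, ← Real.exp_add, Real.exp_le_exp, ← hBk]
    have := hQc (y + k) k
    rw [add_sub_cancel_right, add_assoc] at this
    push_cast
    linarith
  have hR2dom : Integrable fun y => Real.exp (s * b) * Real.exp (-Q (y + (k + k))) :=
    (hρ.comp_add_right (k + k)).const_mul _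
  have hR2i' : Integrable fun y => Real.exp (-Q y) * R y ^ 2 := by
    refine hR2dom.mono' (by fun_prop) (Filter.Eventually.of_forall fun y => ?_)
    rw [Real.norm_of_nonneg (by positivity)]
    exact hR2le y
  have hR2i : Integrable (fun y => R y ^ 2) (gibbs Q) := (integrable_gibbs_iff hQ _).2 hR2i'
  have hR2 : ∫ y, R y ^ 2 ∂(gibbs Q) ≤ Real.exp (s * b) := by
    rw [integral_gibbs hQ]
    refine (integral_mono hR2i' hR2dom hR2le).trans_eq ?_
    rw [integral_const_mul, integral_add_right_eq_self (fun y => Real.exp (-Q y)), hρ1, mul_one]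
  have hRL : MemLp R 2 (gibbs Q) := (memLp_two_iff_integrable_sq hRm.aestronglyMeasurable).2 hR2i
  have haRi : Integrable (fun y => (l ⬝ᵥ y - m) * R y) (gibbs Q) := ha.integrable_mul hRL
  have haR : ∫ y, (l ⬝ᵥ y - m) * R y ∂(gibbs Q) = -(t * b) := by
    rw [integral_gibbs hQ]
    have e1 : ∀ y, Real.exp (-Q y) * ((l ⬝ᵥ y - m) * R y)
        = Real.exp (-Q (y + k)) * ((l ⬝ᵥ (y + k) - m) - t * b) := by
      intro y
      have : Real.exp (-Q (y + k)) = Real.exp (-Q y) * R y := by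
        simp only [hR, ← Real.exp_add]
        ring_nf
      rw [this, dotProduct_add, hlk]
      ring
    simp only [e1]
    rw [integral_add_right_eq_self (fun y => Real.exp (-Q y) * ((l ⬝ᵥ y - m) - t * b)),
      ← integral_gibbs hQ, integral_sub (ha.integrable one_le_two) (integrable_const _), ha0]
    simp
  have hfin : 0 ≤ V - 2 * t⁻¹ * (t * b) + t⁻¹ ^ 2 * (Real.exp (s * b) - 1) := by
    have h0 : 0 ≤ ∫ y, ((l ⬝ᵥ y - m) + t⁻¹ * (R y - 1)) ^ 2 ∂(gibbs Q) :=
      integral_nonneg fun y => sq_nonneg _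
    have e : ∀ y, ((l ⬝ᵥ y - m) + t⁻¹ * (R y - 1)) ^ 2
        = ((l ⬝ᵥ y - m) ^ 2 + 2 * t⁻¹ * ((l ⬝ᵥ y - m) * R y - (l ⬝ᵥ y - m)))
          + t⁻¹ ^ 2 * (R y ^ 2 - 2 * R y + 1) := fun y => by ring
    have i1 : Integrable (fun y => (l ⬝ᵥ y - m) * R y - (l ⬝ᵥ y - m)) (gibbs Q) :=
      haRi.sub (ha.integrable one_le_two)
    have i2 : Integrable (fun y => R y ^ 2 - 2 * R y) (gibbs Q) := hR2i.sub (hR1i.const_mul 2)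
    have i3 : Integrable (fun y => R y ^ 2 - 2 * R y + 1) (gibbs Q) := i2.add (integrable_const _)
    have i4 : Integrable (fun y => (l ⬝ᵥ y - m) ^ 2 + 2 * t⁻¹ * ((l ⬝ᵥ y - m) * R y - (l ⬝ᵥ y - m)))
        (gibbs Q) := ha.integrable_sq.add (i1.const_mul _)
    simp only [e] at h0
    rw [integral_add i4 (i3.const_mul _),
      integral_add ha.integrable_sq (i1.const_mul _), integral_const_mul, integral_const_mul,
      integral_sub haRi (ha.integrable one_le_two), integral_add i2 (integrable_const _),
      integral_sub hR2i (hR1i.const_mul 2), integral_const_mul, ha0, ha2, haR, hR1] at h0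
    simp only [integral_const, probReal_univ, smul_eq_mul, one_mul] at h0
    have hp : 0 < t⁻¹ ^ 2 := by positivity
    nlinarith
  have e : s * (V - 2 * t⁻¹ * (t * b) + t⁻¹ ^ 2 * (Real.exp (s * b) - 1))
      = s * V - 2 * s * b + (Real.exp (s * b) - 1) := by
    rw [← hts]
    field_simp
  nlinarith [mul_nonneg hs.le hfin]

/-! ### Second differences -/

/-- If `f'' ≥ c`, then `f - c t² / 2` is convex, whence a lower bound on second differences. -/
lemma add_two_mul_le_of_le_deriv2 {f f' f'' : ℝ → ℝ} {c : ℝ} (hf : ∀ t, HasDerivAt f (f' t) t)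
    (hf' : ∀ t, HasDerivAt f' (f'' t) t) (hc : ∀ t, c ≤ f'' t) : c + 2 * f 0 ≤ f 1 + f (-1) := by
  have h1 : ∀ t, HasDerivAt (fun t => f t - c / 2 * t ^ 2) (f' t - c * t) t := by
    intro t
    refine ((hf t).sub (((hasDerivAt_id' t).pow 2).const_mul (c / 2))).congr_deriv ?_
    push_cast
    ring
  have h2 : ∀ t, HasDerivAt (fun t => f' t - c * t) (f'' t - c) t := by
    intro t
    refine ((hf' t).sub ((hasDerivAt_id' t).const_mul c)).congr_deriv ?_
    ring
  have e1 : deriv (fun t => f t - c / 2 * t ^ 2) = fun t => f' t - c * t :=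
    funext fun t => (h1 t).deriv
  have hconv : ConvexOn ℝ Set.univ fun t => f t - c / 2 * t ^ 2 := by
    refine convexOn_univ_of_deriv2_nonneg (fun t => (h1 t).differentiableAt) ?_ ?_
    · rw [e1]
      exact fun t => (h2 t).differentiableAt
    · intro t
      rw [Function.iterate_succ, Function.iterate_one, Function.comp_apply, e1, (h2 t).deriv]
      linarith [hc t]
  have := hconv.2 (Set.mem_univ 1) (Set.mem_univ (-1)) (by norm_num : (0 : ℝ) ≤ 1 / 2)
    (by norm_num : (0 : ℝ) ≤ 1 / 2) (by norm_num)
  simp only [smul_eq_mul] at this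
  norm_num at this
  linarith

/-- Second differences of a function with gradient `g` and Hessian `L`. -/
lemma le_second_difference {φ : Vec d → ℝ} {g : Vec d → Vec d} {L : Vec d → Vec d →L[ℝ] Vec d}
    (hφ : ∀ x, HasFDerivAt φ (dotCLM (g x)) x) (hg : ∀ x, HasFDerivAt g (L x) x) {c : ℝ}
    {δ : Vec d} (hc : ∀ x, c ≤ δ ⬝ᵥ L x δ) (x : Vec d) :
    c + 2 * φ x ≤ φ (x + δ) + φ (x - δ) := by
  have hline : ∀ t : ℝ, HasDerivAt (fun t : ℝ => x + t • δ) δ t := by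
    intro t
    simpa using ((hasDerivAt_id t).smul_const δ).const_add x
  have h1 : ∀ t : ℝ, HasDerivAt (fun t : ℝ => φ (x + t • δ)) (dotCLM δ (g (x + t • δ))) t := by
    intro t
    have := (hφ (x + t • δ)).comp_hasDerivAt t (hline t)
    rwa [dotCLM_apply, dotProduct_comm, ← dotCLM_apply] at this
  have h2 : ∀ t : ℝ, HasDerivAt (fun t : ℝ => dotCLM δ (g (x + t • δ)))
      (dotCLM δ (L (x + t • δ) δ)) t := by
    intro t
    have := (hg (x + t • δ)).comp_hasDerivAt t (hline t)
    exact (dotCLM δ).hasFDerivAt.comp_hasDerivAt t this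
  have := add_two_mul_le_of_le_deriv2 h1 h2 (c := c) fun t => by simpa using hc _
  simpa [sub_eq_add_neg] using this

lemma second_difference_le {φ : Vec d → ℝ} {g : Vec d → Vec d} {L : Vec d → Vec d →L[ℝ] Vec d}
    (hφ : ∀ x, HasFDerivAt φ (dotCLM (g x)) x) (hg : ∀ x, HasFDerivAt g (L x) x) {c : ℝ}
    {δ : Vec d} (hc : ∀ x, δ ⬝ᵥ L x δ ≤ c) (x : Vec d) :
    φ (x + δ) + φ (x - δ) ≤ c + 2 * φ x := by
  have hneg : ∀ y : Vec d, dotCLM (-y) = -dotCLM y := fun y => by ext; simp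
  have := le_second_difference (φ := fun x => -φ x) (g := fun x => -g x) (L := fun x => -L x)
    (fun x => by rw [hneg]; exact (hφ x).neg) (fun x => (hg x).neg) (c := -c) (δ := δ)
    (fun x => by simpa using hc x) x
  linarith

/-- The quadratic form does not see that `gradMat` is the transpose of the Jacobian matrix. -/
lemma dotProduct_fderiv_self (h : Vec d → Vec d) (x δ : Vec d) :
    δ ⬝ᵥ fderiv ℝ h x δ = quad (gradMat h x) δ := by
  have e : fderiv ℝ h x δ = (gradMat h x)ᵀ *ᵥ δ := by
    have h1 : δ = ∑ i, δ i • (Pi.single i 1 : Vec d) := by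
      simpa using pi_eq_sum_univ' δ
    conv_lhs => rw [h1, map_sum]
    ext j
    simp [mulVec, dotProduct, gradMat, mul_comm]
  rw [e, quad, dotProduct_mulVec, vecMul_transpose, dotProduct_comm]

lemma hasFDerivAt_of_contDiff {U : Vec d → ℝ} (hU : ContDiff ℝ 2 U) (x : Vec d) :
    HasFDerivAt U (dotCLM (grad U x)) x := by
  have h1 : DifferentiableAt ℝ U x := (hU.differentiable (by norm_num)) x
  refine h1.hasFDerivAt.congr_fderiv ?_
  refine ContinuousLinearMap.coe_injective (LinearMap.pi_ext' fun i => LinearMap.ext_ring ?_)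
  simp [grad]

lemma differentiable_grad {U : Vec d → ℝ} (hU : ContDiff ℝ 2 U) : Differentiable ℝ (grad U) := by
  have h1 : ContDiff ℝ 1 (fderiv ℝ U) := hU.fderiv_right (by norm_num)
  have h2 : Differentiable ℝ (fderiv ℝ U) := h1.differentiable (by norm_num)
  refine differentiable_pi.2 fun i => ?_
  exact h2.clm_apply (differentiable_const _)

lemma le_second_difference_of_le_hess {U : Vec d → ℝ} (hU : ContDiff ℝ 2 U) {B : Mat d}
    (h : ∀ x, B ≤ hess U x) (x δ : Vec d) : quad B δ + 2 * U x ≤ U (x + δ) + U (x - δ) :=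
  le_second_difference (hasFDerivAt_of_contDiff hU)
    (fun x => (differentiable_grad hU x).hasFDerivAt)
    (fun x => by rw [dotProduct_fderiv_self]; exact quad_le_of_le (h x) δ) x

lemma second_difference_le_of_hess_le {U : Vec d → ℝ} (hU : ContDiff ℝ 2 U) {B : Mat d}
    (h : ∀ x, hess U x ≤ B) (x δ : Vec d) : U (x + δ) + U (x - δ) ≤ quad B δ + 2 * U x :=
  second_difference_le (hasFDerivAt_of_contDiff hU)
    (fun x => (differentiable_grad hU x).hasFDerivAt)
    (fun x => by rw [dotProduct_fderiv_self]; exact quad_le_of_le (h x) δ) x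

lemma HasExpMoments.le_second_difference_log_laplace {ν : Measure (Vec d)} [NeZero ν]
    (h : HasExpMoments ν) {s : Mat d} (hs : ∀ θ, s ≤ covMat (expTilt ν θ)) (θ δ : Vec d) :
    quad s δ + 2 * Real.log (laplace ν θ)
      ≤ Real.log (laplace ν (θ + δ)) + Real.log (laplace ν (θ - δ)) :=
  le_second_difference h.hasFDerivAt_log_laplace h.hasFDerivAt_mean
    (fun x => by simpa [quad] using quad_le_of_le (hs x) δ) θ

lemma HasExpMoments.second_difference_log_laplace_le {ν : Measure (Vec d)} [NeZero ν]
    (h : HasExpMoments ν) {s : Mat d} (hs : ∀ θ, covMat (expTilt ν θ) ≤ s) (θ δ : Vec d) :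
    Real.log (laplace ν (θ + δ)) + Real.log (laplace ν (θ - δ))
      ≤ quad s δ + 2 * Real.log (laplace ν θ) :=
  second_difference_le h.hasFDerivAt_log_laplace h.hasFDerivAt_mean
    (fun x => by simpa [quad] using quad_le_of_le (hs x) δ) θ

/-! ### Riccati maps -/

lemma isUnit_det_of_posDef {A : Mat d} (hA : A.PosDef) : IsUnit A.det :=
  (Matrix.isUnit_iff_isUnit_det _).mp hA.isUnit

lemma ricc_eq_one_sub {ϖ s : Mat d} (hϖ : ϖ.PosDef) (hs : s.PosSemidef) :
    ricc ϖ s = 1 - (ϖ + s + 1)⁻¹ := by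
  have hX : (ϖ + s).PosDef := hϖ.add_posSemidef hs
  have h1 := isUnit_det_of_posDef hX
  have h2 := isUnit_det_of_posDef (hX.add PosDef.one)
  refine Matrix.inv_eq_right_inv ?_
  set X := ϖ + s
  have e1 : (1 + X⁻¹) = X⁻¹ * (X + 1) := by
    rw [mul_add, Matrix.nonsing_inv_mul _ h1, mul_one]
  rw [mul_sub, mul_one, e1, mul_assoc, Matrix.mul_nonsing_inv _ h2, mul_one, mul_add,
    Matrix.nonsing_inv_mul _ h1, mul_one]
  abel

lemma ricc_posSemidef {ϖ s : Mat d} (hϖ : ϖ.PosDef) (hs : s.PosSemidef) :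
    (ricc ϖ s).PosSemidef :=
  (PosDef.one.add (hϖ.add_posSemidef hs).inv).inv.posSemidef

/-- A positive semidefinite fixed point solves the quadratic equation `X² = ϖ (X + 1)` with
`X = ϖ + s`, hence commutes with `ϖ`, and completing the square identifies it. -/
lemma eq_riccFix {ϖ s : Mat d} (hϖ : ϖ.PosDef) (hs : s.PosSemidef) (h : ricc ϖ s = s) :
    s = riccFix ϖ := by
  have hX : (ϖ + s).PosDef := hϖ.add_posSemidef hs
  have h2 := isUnit_det_of_posDef (hX.add PosDef.one)
  rw [ricc_eq_one_sub hϖ hs] at h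
  have e1 : s * (ϖ + s + 1) = ϖ + s := by
    nth_rewrite 1 [← h]
    rw [sub_mul, one_mul, Matrix.nonsing_inv_mul _ h2]
    abel
  have e2 : s * ϖ + s * s = ϖ := by
    have : s * (ϖ + s + 1) = s * ϖ + s * s + s := by noncomm_ring
    rw [this] at e1
    exact add_right_cancel e1
  have e3 : ϖ * s + s * s = ϖ := by
    have := congrArg Matrix.transpose e2
    rwa [transpose_add, transpose_mul, transpose_mul, transpose_eq_of_isHermitian hs.1,
      transpose_eq_of_isHermitian hϖ.1] at this
  have hh : ((1 / 2 : ℝ) • ϖ).PosSemidef := (hϖ.smul (by norm_num)).posSemidef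
  have hsq : msqrt (ϖ + ((1 / 2 : ℝ) • ϖ) ^ 2) = s + (1 / 2 : ℝ) • ϖ := by
    refine CFC.sqrt_unique ?_ (hs.add hh).nonneg
    have e4 : (s + (1 / 2 : ℝ) • ϖ) * (s + (1 / 2 : ℝ) • ϖ)
        = (1 / 2 : ℝ) • (s * ϖ + s * s) + (1 / 2 : ℝ) • (ϖ * s + s * s)
          + ((1 / 2 : ℝ) • ϖ) ^ 2 := by
      simp only [add_mul, mul_add, smul_mul_assoc, mul_smul_comm, sq]
      module
    rw [e4, e2, e3]
    module
  rw [riccFix, hsq]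
  abel

lemma quad_one (x : Vec d) : quad (1 : Mat d) x = x ⬝ᵥ x := by simp [quad]

lemma dotProduct_self_nonneg (x : Vec d) : 0 ≤ x ⬝ᵥ x :=
  Finset.sum_nonneg fun i _ => mul_self_nonneg (x i)

lemma exists_quad_le (M : Mat d) : ∃ C : ℝ, 0 < C ∧ ∀ x, quad M x ≤ C * (x ⬝ᵥ x) := by
  refine ⟨∑ i, ∑ j, |M i j| + 1, by positivity, fun x => ?_⟩
  have hx : ∀ i, x i * x i ≤ x ⬝ᵥ x := fun i =>
    Finset.single_le_sum (f := fun i => x i * x i) (fun i _ => mul_self_nonneg _)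
      (Finset.mem_univ i)
  have h : quad M x ≤ (∑ i, ∑ j, |M i j|) * (x ⬝ᵥ x) := by
    have e : quad M x = ∑ i, ∑ j, x i * (M i j * x j) := by
      simp [quad, dotProduct, mulVec, Finset.mul_sum]
    rw [e, Finset.sum_mul]
    refine Finset.sum_le_sum fun i _ => ?_
    rw [Finset.sum_mul]
    refine Finset.sum_le_sum fun j _ => ?_
    have h1 : |x i * x j| ≤ x ⬝ᵥ x := by
      have h2 := hx i
      have h3 := hx j
      rw [abs_le]
      constructor <;> nlinarith [sq_nonneg (x i - x j), sq_nonneg (x i + x j)]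
    calc x i * (M i j * x j) = M i j * (x i * x j) := by ring
      _ ≤ |M i j| * |x i * x j| := by rw [← abs_mul]; exact le_abs_self _
      _ ≤ |M i j| * (x ⬝ᵥ x) := by gcongr
  nlinarith [dotProduct_self_nonneg x]

/-- A positive definite matrix is bounded below by a multiple of the identity, by Young's
inequality and an upper bound on its inverse. -/
lemma exists_pos_le_quad {M : Mat d} (hM : M.PosDef) :
    ∃ c : ℝ, 0 < c ∧ ∀ x, c * (x ⬝ᵥ x) ≤ quad M x := by
  obtain ⟨C, hC, h⟩ := exists_quad_le M⁻¹
  refine ⟨C⁻¹, inv_pos.2 hC, fun x => ?_⟩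
  have h1 := two_mul_dotProduct_le hM (C⁻¹ • x) x
  have h2 := h (C⁻¹ • x)
  simp only [smul_dotProduct, dotProduct_smul, smul_eq_mul] at h1 h2
  have : C * (C⁻¹ * (C⁻¹ * (x ⬝ᵥ x))) = C⁻¹ * (x ⬝ᵥ x) := by field_simp
  linarith

/-- The Riccati map contracts towards its fixed point. -/
lemma exists_contraction_ricc {ϖ : Mat d} (hϖ : ϖ.PosDef) :
    ∃ κ : ℝ, 0 ≤ κ ∧ κ < 1 ∧ ∀ t : ℝ, 0 ≤ t → ∀ x,
      quad (ricc ϖ (riccFix ϖ + t • 1)) x ≤ quad (riccFix ϖ) x + κ * t * (x ⬝ᵥ x) := by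
  obtain ⟨c, hc, hcx⟩ := exists_pos_le_quad hϖ
  obtain ⟨hr, hfix⟩ := riccFix_spec hϖ
  set r := riccFix ϖ with hr_def
  refine ⟨(1 + 2 * c)⁻¹, by positivity, inv_lt_one_of_one_lt₀ (by linarith), fun t ht x => ?_⟩
  have ht1 : (t • (1 : Mat d)).PosSemidef := PosSemidef.one.smul ht
  have hX : (ϖ + r + 1).PosDef := (hϖ.add hr).add PosDef.one
  have hXt : (ϖ + r + 1 + t • (1 : Mat d)).PosDef := hX.add_posSemidef ht1
  have e1 : ricc ϖ (r + t • 1) = 1 - (ϖ + r + 1 + t • (1 : Mat d))⁻¹ := by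
    rw [ricc_eq_one_sub hϖ (hr.posSemidef.add ht1)]
    congr 2
    abel
  have e2 : r = 1 - (ϖ + r + 1)⁻¹ := by
    nth_rewrite 1 [← hfix]
    exact ricc_eq_one_sub hϖ hr.posSemidef
  have esub : ∀ (A B : Mat d), quad (A - B) x = quad A x - quad B x := fun A B => by
    simp [quad, sub_mulVec, dotProduct_sub]
  set X := ϖ + r + 1 with hX_def
  set w := X⁻¹ *ᵥ x with hw
  have hXw : X *ᵥ w = x := by
    rw [hw, mulVec_mulVec, Matrix.mul_nonsing_inv _ (isUnit_det_of_posDef hX), one_mulVec]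
  -- the inverse of `X + t` is bounded below by testing Young's inequality with `w = X⁻¹ x`
  have h1 := two_mul_dotProduct_le hXt x w
  have h2 : quad (X + t • (1 : Mat d)) w = quad X w + t * (w ⬝ᵥ w) := by
    rw [quad_add]
    simp [quad, smul_mulVec]
  have h3 : quad X w = quad X⁻¹ x := quad_inv hX x
  have h4 : x ⬝ᵥ w = quad X⁻¹ x := rfl
  have h5 : (1 + c) * (w ⬝ᵥ w) ≤ quad X w := by
    have := quad_nonneg hr.posSemidef w
    have h6 := hcx w
    rw [hX_def, quad_add, quad_add, quad_one]
    linarith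
  have h6 : quad X w ≤ (w ⬝ᵥ w + x ⬝ᵥ x) / 2 := by
    have := dotProduct_self_nonneg (w - x)
    simp only [sub_dotProduct, dotProduct_sub] at this
    rw [quad, hXw]
    rw [dotProduct_comm x w] at this
    linarith
  have h7 : w ⬝ᵥ w ≤ (1 + 2 * c)⁻¹ * (x ⬝ᵥ x) := by
    rw [← div_eq_inv_mul, le_div_iff₀ (by positivity)]
    linarith
  have h8 : t * (w ⬝ᵥ w) ≤ t * ((1 + 2 * c)⁻¹ * (x ⬝ᵥ x)) := by gcongr
  have e3 : quad r x = quad 1 x - quad X⁻¹ x := by rw [← esub, ← e2]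
  rw [e1, esub, e3]
  linarith

/-- Conjugation by `a = v^{1/2}` turns the composition of the two one-sided covariance bounds into
the Riccati map. -/
lemma inv_add_conj_eq_ricc {a χ : Mat d} (ha : a.PosDef) (hχ : IsUnit χ) (u R : Mat d) :
    ((a * a)⁻¹ + χ * (u⁻¹ + χᵀ * (a * R * a) * χ)⁻¹ * χᵀ)⁻¹
      = a * ricc ((a * (χ * u * χᵀ) * a)⁻¹) R * a := by
  have haT : aᵀ = a := transpose_eq_of_isHermitian ha.1
  have hda := isUnit_det_of_posDef ha
  have hdχ : IsUnit χ.det := (Matrix.isUnit_iff_isUnit_det _).mp hχ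
  have hdχT : IsUnit χᵀ.det := by rwa [det_transpose]
  have c1 : a⁻¹ * a = 1 := Matrix.nonsing_inv_mul _ hda
  have c2 : a * a⁻¹ = 1 := Matrix.mul_nonsing_inv _ hda
  have c3 : χ⁻¹ * χ = 1 := Matrix.nonsing_inv_mul _ hdχ
  have c4 : χᵀ * χᵀ⁻¹ = 1 := Matrix.mul_nonsing_inv _ hdχT
  have e1 : u⁻¹ + χᵀ * (a * R * a) * χ
      = χᵀ * a * ((a * (χ * u * χᵀ) * a)⁻¹ + R) * (a * χ) := by
    simp only [Matrix.mul_inv_rev, mul_add, add_mul]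
    congr 1
    · calc u⁻¹ = 1 * 1 * u⁻¹ * (1 * 1) := by simp
        _ = (χᵀ * (a * a⁻¹) * χᵀ⁻¹) * 1 * u⁻¹ * (χ⁻¹ * (a⁻¹ * a) * χ) := by
            simp only [c2, c1, mul_one, one_mul, c4, c3]
        _ = _ := by simp only [mul_assoc, one_mul]
    · simp only [mul_assoc]
  have e2 : χ * (u⁻¹ + χᵀ * (a * R * a) * χ)⁻¹ * χᵀ
      = a⁻¹ * ((a * (χ * u * χᵀ) * a)⁻¹ + R)⁻¹ * a⁻¹ := by
    rw [e1, Matrix.mul_inv_rev, Matrix.mul_inv_rev (χᵀ * a), Matrix.mul_inv_rev a χ,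
      Matrix.mul_inv_rev χᵀ a]
    set Y := ((a * (χ * u * χᵀ) * a)⁻¹ + R)⁻¹
    have c5 : χ * χ⁻¹ = 1 := Matrix.mul_nonsing_inv _ hdχ
    have c6 : χᵀ⁻¹ * χᵀ = 1 := Matrix.nonsing_inv_mul _ hdχT
    calc χ * (χ⁻¹ * a⁻¹ * (Y * (a⁻¹ * χᵀ⁻¹))) * χᵀ
        = (χ * χ⁻¹) * a⁻¹ * Y * a⁻¹ * (χᵀ⁻¹ * χᵀ) := by simp only [mul_assoc]
      _ = _ := by rw [c5, c6]; simp
  rw [e2, ricc]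
  set Y := ((a * (χ * u * χᵀ) * a)⁻¹ + R)⁻¹
  have e3 : (a * a)⁻¹ + a⁻¹ * Y * a⁻¹ = a⁻¹ * (1 + Y) * a⁻¹ := by
    rw [Matrix.mul_inv_rev]
    noncomm_ring
  rw [e3, Matrix.mul_inv_rev, Matrix.mul_inv_rev, Matrix.nonsing_inv_nonsing_inv _ hda, mul_assoc]

lemma posDef_msqrt {v : Mat d} (hv : v.PosDef) : (msqrt v).PosDef := by
  have h0 : (msqrt v).PosSemidef := (CFC.sqrt_nonneg v).posSemidef
  rw [h0.posDef_iff_isUnit]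
  have h1 : msqrt v * msqrt v = v := CFC.sqrt_mul_sqrt_self _ hv.posSemidef.nonneg
  rw [Matrix.isUnit_iff_isUnit_det]
  have h2 := isUnit_det_of_posDef hv
  rw [← h1, det_mul] at h2
  exact isUnit_of_mul_isUnit_left h2

lemma posDef_conj {u χ : Mat d} (hu : u.PosDef) (hχ : IsUnit χ) : (χ * u * χᵀ).PosDef := by
  have h : (χ * u * χᵀ).PosSemidef := by
    simpa using hu.posSemidef.mul_mul_conjTranspose_same χ
  rw [h.posDef_iff_isUnit]
  exact (hχ.mul hu.isUnit).mul ((Matrix.isUnit_transpose _).2 hχ)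

lemma quad_symm_conj {a : Mat d} (ha : a.IsHermitian) (R : Mat d) (x : Vec d) :
    quad (a * R * a) x = quad R (a *ᵥ x) := by
  have := quad_conj R a x
  rwa [transpose_eq_of_isHermitian ha] at this

lemma posSemidef_symm_conj {a R : Mat d} (ha : a.IsHermitian) (hR : R.PosSemidef) :
    (a * R * a).PosSemidef := by
  have := hR.conjTranspose_mul_mul_same a
  rwa [ha.eq] at this

/-- A positive definite `ω` vanishes only in dimension zero, where all matrices coincide. -/
lemma riccFixOfInv_of_posDef {ω : Mat d} (hω : ω.PosDef) : riccFixOfInv ω = riccFix ω⁻¹ := by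
  unfold riccFixOfInv
  split_ifs with h
  · rcases Nat.eq_zero_or_pos d with rfl | hd
    · exact Subsingleton.elim _ _
    · exfalso
      have := hω.diag_pos (i := ⟨0, hd⟩)
      simp [h] at this
  · rfl

/-- The Riccati bounds, from the two one-sided covariance bounds `hA` and `hB`. Starting from
`Sx ≤ v`, alternating `hB` and `hA` yields `Sx ≤ v^{1/2} R v^{1/2}` for all Riccati iterates `R`;
the lower bound on `Sy` is the image under `hB` of the limit. -/
theorem riccati_bounds_of_alternating {ι κ : Type*} {Sx : ι → Mat d} {Sy : κ → Mat d} {u v χ : Mat d}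
    (hu : u = 0 ∨ u.PosDef) (hv : v.PosDef) (hχ : IsUnit χ)
    (hSx : ∀ x, (Sx x).IsHermitian) (hSy : ∀ y, (Sy y).PosSemidef)
    (hA : ∀ s : Mat d, s.PosSemidef → (∀ y, s ≤ Sy y) → ∀ x, Sx x ≤ (v⁻¹ + χ * s * χᵀ)⁻¹)
    (hB : u ≠ 0 → ∀ S : Mat d, S.PosSemidef → (∀ x, Sx x ≤ S) →
      ∀ y, (u⁻¹ + χᵀ * S * χ)⁻¹ ≤ Sy y) :
    (∀ x, Sx x ≤ msqrt v * riccFixOfInv (msqrt v * (χ * u * χᵀ) * msqrt v) * msqrt v) ∧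
    (∀ y, msqrt u * riccFixOfInv (msqrt u * (χᵀ * v * χ) * msqrt u) * msqrt u ≤ Sy y) := by
  set a := msqrt v with ha_def
  have ha : a.PosDef := posDef_msqrt hv
  have haa : a * a = v := CFC.sqrt_mul_sqrt_self _ hv.posSemidef.nonneg
  have hbase : ∀ x, Sx x ≤ v := by
    intro x
    have := hA 0 PosSemidef.zero (fun y => (hSy y).nonneg) x
    simpa [Matrix.nonsing_inv_nonsing_inv _ (isUnit_det_of_posDef hv)] using this
  by_cases hu0 : u = 0
  · subst hu0
    have hs0 : msqrt (0 : Mat d) = 0 := CFC.sqrt_zero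
    constructor
    · intro x
      simpa [riccFixOfInv, haa] using hbase x
    · intro y
      simpa [hs0] using (hSy y).nonneg
  have hu : u.PosDef := hu.resolve_left hu0
  have hB := hB hu0
  have hω : (a * (χ * u * χᵀ) * a).PosDef := by
    have := posDef_conj (posDef_conj hu hχ) ha.isUnit
    rwa [transpose_eq_of_isHermitian ha.1] at this
  have hϖ : ((a * (χ * u * χᵀ) * a)⁻¹).PosDef := hω.inv
  set ϖ := (a * (χ * u * χᵀ) * a)⁻¹ with hϖ_def
  obtain ⟨hr, hfix⟩ := riccFix_spec hϖ
  have hstep : ∀ R : Mat d, R.PosSemidef → (∀ x, Sx x ≤ a * R * a) →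
      ∀ x, Sx x ≤ a * ricc ϖ R * a := by
    intro R hR h x
    have hS := posSemidef_symm_conj ha.1 hR
    have hT : (u⁻¹ + χᵀ * (a * R * a) * χ).PosDef :=
      hu.inv.add_posSemidef (by simpa using hS.conjTranspose_mul_mul_same χ)
    have := hA _ hT.inv.posSemidef (hB _ hS h) x
    rwa [← haa, inv_add_conj_eq_ricc ha hχ] at this
  obtain ⟨κ, hκ0, hκ1, hκ⟩ := exists_contraction_ricc hϖ
  have hiter : ∀ n : ℕ, ∀ x, Sx x ≤ a * (riccFix ϖ + κ ^ n • 1) * a := by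
    intro n
    induction n with
    | zero =>
      intro x
      refine (hbase x).trans (Matrix.le_iff.2 ?_)
      have e : a * (riccFix ϖ + κ ^ 0 • 1) * a - v = a * riccFix ϖ * a := by
        rw [← haa, pow_zero, one_smul]
        noncomm_ring
      rw [e]
      exact posSemidef_symm_conj ha.1 hr.posSemidef
    | succ n ih =>
      intro x
      have hpsd : (riccFix ϖ + κ ^ n • (1 : Mat d)).PosSemidef :=
        hr.posSemidef.add (PosSemidef.one.smul (pow_nonneg hκ0 n))
      refine (hstep _ hpsd ih x).trans ?_
      have hpsd' : (riccFix ϖ + κ ^ (n + 1) • (1 : Mat d)).PosSemidef :=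
        hr.posSemidef.add (PosSemidef.one.smul (pow_nonneg hκ0 _))
      refine le_of_quad_le (posSemidef_symm_conj ha.1 (ricc_posSemidef hϖ hpsd)).1
        (posSemidef_symm_conj ha.1 hpsd').1 fun z => ?_
      rw [quad_symm_conj ha.1, quad_symm_conj ha.1]
      refine (hκ _ (pow_nonneg hκ0 n) _).trans_eq ?_
      rw [quad_add, pow_succ']
      simp [quad, smul_mulVec]
  have hup : ∀ x, Sx x ≤ a * riccFix ϖ * a := by
    intro x
    refine le_of_quad_le (hSx x) (posSemidef_symm_conj ha.1 hr.posSemidef).1 fun z => ?_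
    have hlim : Filter.Tendsto (fun n : ℕ => quad (riccFix ϖ) (a *ᵥ z)
        + κ ^ n * ((a *ᵥ z) ⬝ᵥ (a *ᵥ z))) Filter.atTop
        (nhds (quad (riccFix ϖ) (a *ᵥ z) + 0 * ((a *ᵥ z) ⬝ᵥ (a *ᵥ z)))) :=
      ((tendsto_pow_atTop_nhds_zero_of_lt_one hκ0 hκ1).mul_const _).const_add _
    rw [zero_mul, add_zero] at hlim
    rw [quad_symm_conj ha.1]
    refine ge_of_tendsto' hlim fun n => ?_
    have := quad_le_of_le (hiter n x) z
    rw [quad_symm_conj ha.1, quad_add] at this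
    simpa [quad, smul_mulVec] using this
  refine ⟨fun x => by rw [riccFixOfInv_of_posDef hω]; exact hup x, fun y => ?_⟩
  -- the lower bound: the image of the upper fixed point solves the dual fixed point equation
  set c := msqrt u with hc_def
  have hc : c.PosDef := posDef_msqrt hu
  have hcc : c * c = u := CFC.sqrt_mul_sqrt_self _ hu.posSemidef.nonneg
  have hχT : IsUnit χᵀ := (Matrix.isUnit_transpose _).2 hχ
  have hω1 : (c * (χᵀ * v * χ) * c).PosDef := by
    have := posDef_conj (posDef_conj hv hχT) hc.isUnit
    rwa [transpose_eq_of_isHermitian hc.1, transpose_transpose] at this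
  set S := a * riccFix ϖ * a with hS_def
  have hS : S.PosSemidef := posSemidef_symm_conj ha.1 hr.posSemidef
  have hTinv : (u⁻¹ + χᵀ * S * χ).PosDef :=
    hu.inv.add_posSemidef (by simpa using hS.conjTranspose_mul_mul_same χ)
  set T := (u⁻¹ + χᵀ * S * χ)⁻¹ with hT_def
  have hT : T.PosDef := hTinv.inv
  have hST : S = (v⁻¹ + χ * T * χᵀ)⁻¹ := by
    have := inv_add_conj_eq_ricc ha hχ u (riccFix ϖ)
    rw [← hϖ_def, hfix, haa] at this
    exact this.symm
  have hdc := isUnit_det_of_posDef hc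
  have c1 : c⁻¹ * c = 1 := Matrix.nonsing_inv_mul _ hdc
  have c2 : c * c⁻¹ = 1 := Matrix.mul_nonsing_inv _ hdc
  set s := c⁻¹ * T * c⁻¹ with hs_def
  have hs : s.PosSemidef := posSemidef_symm_conj hc.inv.1 hT.posSemidef
  have hcs : c * s * c = T := by
    calc c * s * c = (c * c⁻¹) * T * (c⁻¹ * c) := by rw [hs_def]; simp only [mul_assoc]
      _ = T := by rw [c1, c2, one_mul, mul_one]
  have hfix1 : ricc ((c * (χᵀ * v * χ) * c)⁻¹) s = s := by
    have := inv_add_conj_eq_ricc hc hχT v s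
    rw [transpose_transpose, hcs, ← hST, hcc, ← hT_def] at this
    generalize ricc ((c * (χᵀ * v * χ) * c)⁻¹) s = Y at this ⊢
    calc Y = (c⁻¹ * c) * Y * (c * c⁻¹) := by rw [c1, c2, one_mul, mul_one]
      _ = c⁻¹ * (c * Y * c) * c⁻¹ := by simp only [mul_assoc]
      _ = s := by rw [← this]
  rw [riccFixOfInv_of_posDef hω1, ← eq_riccFix hω1.inv hs hfix1, hcs]
  exact hB S hS hup y

/-! ### Dual pairs of potentials -/

lemma mulVec_surjective {χ : Mat d} (hχ : IsUnit χ) (θ : Vec d) : ∃ x, χ *ᵥ x = θ :=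
  ⟨χ⁻¹ *ᵥ θ, by rw [mulVec_mulVec, Matrix.mul_nonsing_inv _
    ((Matrix.isUnit_iff_isUnit_det _).mp hχ), one_mulVec]⟩

/-- The Schrödinger system for the bilinear cost `-y · χ x`: up to the marginal potentials `U` and
`V`, each of the potentials `p` and `q` is the log-Laplace transform of the Gibbs measure of the
other one. The system is invariant under the exchange of `(U, p, χ)` and `(V, q, χ')`. -/
structure IsDualPair (U V : Vec d → ℝ) (χ : Mat d) (p q : Vec d → ℝ) : Prop where
  measurable_left : Measurable p
  measurable_right : Measurable q
  hasExpMoments_left : HasExpMoments (gibbs p)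
  hasExpMoments_right : HasExpMoments (gibbs q)
  eq_left : ∀ x, p x = U x + Real.log (laplace (gibbs q) (χ *ᵥ x))
  eq_right : ∀ y, q y = V y + Real.log (laplace (gibbs p) (χᵀ *ᵥ y))

lemma IsDualPair.swap {U V : Vec d → ℝ} {χ : Mat d} {p q : Vec d → ℝ}
    (h : IsDualPair U V χ p q) : IsDualPair V U χᵀ q p :=
  ⟨h.measurable_right, h.measurable_left, h.hasExpMoments_right, h.hasExpMoments_left, h.eq_right,
    by simpa using h.eq_left⟩

/-- A lower bound on the backward covariances and on `∇²V` gives an upper bound on the forward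
covariances. -/
lemma IsDualPair.covMat_le {U V : Vec d → ℝ} {χ : Mat d} {p q : Vec d → ℝ}
    (h : IsDualPair U V χ p q) (hV : ContDiff ℝ 2 V) (hχ : IsUnit χ) {v s : Mat d} (hv : v.PosDef)
    (hVv : ∀ y, v⁻¹ ≤ hess V y) (hs : s.PosSemidef)
    (hS : ∀ y, s ≤ covMat (expTilt (gibbs p) (χᵀ *ᵥ y))) (θ : Vec d) :
    covMat (expTilt (gibbs q) θ) ≤ (v⁻¹ + χ * s * χᵀ)⁻¹ := by
  have := gibbs_neZero h.measurable_left
  have hpsd : (χ * s * χᵀ).PosSemidef := by simpa using hs.mul_mul_conjTranspose_same χ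
  have hS' : ∀ θ, s ≤ covMat (expTilt (gibbs p) θ) := fun θ => by
    obtain ⟨y, rfl⟩ := mulVec_surjective ((Matrix.isUnit_transpose _).2 hχ) θ
    exact hS y
  refine covMat_expTilt_le h.measurable_right h.hasExpMoments_right
    (hv.inv.add_posSemidef hpsd) (fun y δ => ?_) θ
  have h1 := le_second_difference_of_le_hess hV hVv y δ
  have h2 := h.hasExpMoments_left.le_second_difference_log_laplace hS' (χᵀ *ᵥ y) (χᵀ *ᵥ δ)
  have h3 := quad_conj s χᵀ δ
  rw [transpose_transpose] at h3
  rw [quad_add, h3, h.eq_right, h.eq_right, h.eq_right, mulVec_add, mulVec_sub]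
  linarith

/-- An upper bound on the backward covariances and on `∇²V` gives a lower bound on the forward
covariances. -/
lemma IsDualPair.le_covMat {U V : Vec d → ℝ} {χ : Mat d} {p q : Vec d → ℝ}
    (h : IsDualPair U V χ p q) (hV : ContDiff ℝ 2 V) (hχ : IsUnit χ) {v S : Mat d} (hv : v.PosDef)
    (hVv : ∀ y, hess V y ≤ v⁻¹) (hs : S.PosSemidef)
    (hS : ∀ y, covMat (expTilt (gibbs p) (χᵀ *ᵥ y)) ≤ S) (θ : Vec d) :
    (v⁻¹ + χ * S * χᵀ)⁻¹ ≤ covMat (expTilt (gibbs q) θ) := by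
  have := gibbs_neZero h.measurable_left
  have hpsd : (χ * S * χᵀ).PosSemidef := by simpa using hs.mul_mul_conjTranspose_same χ
  have hS' : ∀ θ, covMat (expTilt (gibbs p) θ) ≤ S := fun θ => by
    obtain ⟨y, rfl⟩ := mulVec_surjective ((Matrix.isUnit_transpose _).2 hχ) θ
    exact hS y
  refine inv_le_covMat_expTilt h.measurable_right h.hasExpMoments_right
    (hv.inv.add_posSemidef hpsd) (fun y δ => ?_) θ
  have h1 := second_difference_le_of_hess_le hV hVv y δ
  have h2 := h.hasExpMoments_left.second_difference_log_laplace_le hS' (χᵀ *ᵥ y) (χᵀ *ᵥ δ)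
  have h3 := quad_conj S χᵀ δ
  rw [transpose_transpose] at h3
  rw [quad_add, h3, h.eq_right, h.eq_right, h.eq_right, mulVec_add, mulVec_sub]
  linarith

/-- The covariance bounds for one choice of the side on which the two Hessians are bounded; the
other choice is obtained from `IsDualPair.swap`. -/
theorem IsDualPair.riccati_bounds {U V : Vec d → ℝ} {χ : Mat d} {p q : Vec d → ℝ}
    (h : IsDualPair U V χ p q) (hU : ContDiff ℝ 2 U) (hV : ContDiff ℝ 2 V) (hχ : IsUnit χ)
    {u v : Mat d} (hu : u = 0 ∨ u.PosDef) (hv : v.PosDef)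
    (hUu : u ≠ 0 → ∀ x, hess U x ≤ u⁻¹) (hVv : ∀ y, v⁻¹ ≤ hess V y) :
    (∀ x, covMat (expTilt (gibbs q) (χ *ᵥ x))
      ≤ msqrt v * riccFixOfInv (msqrt v * (χ * u * χᵀ) * msqrt v) * msqrt v) ∧
    (∀ y, msqrt u * riccFixOfInv (msqrt u * (χᵀ * v * χ) * msqrt u) * msqrt u
      ≤ covMat (expTilt (gibbs p) (χᵀ *ᵥ y))) := by
  have := gibbs_neZero h.measurable_left
  refine riccati_bounds_of_alternating hu hv hχ (fun x => covMat_isHermitian _) (fun y => ?_)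
    (fun s hs hS x => h.covMat_le hV hχ hv hVv hs hS _) (fun hu0 S hs hS y => ?_)
  · have := h.hasExpMoments_left.isProbabilityMeasure_expTilt (χᵀ *ᵥ y)
    exact covMat_posSemidef (h.hasExpMoments_left.memLp_two_expTilt _)
  · have := h.swap.le_covMat hU ((Matrix.isUnit_transpose _).2 hχ) (hu.resolve_left hu0) (hUu hu0) hs
      (by simpa using hS) (χᵀ *ᵥ y)
    rwa [transpose_transpose] at this

lemma conj_le_conj {A B : Mat d} (h : A ≤ B) (χ : Mat d) : χᵀ * A * χ ≤ χᵀ * B * χ := by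
  have h1 := (Matrix.le_iff.1 h).conjTranspose_mul_mul_same χ
  rw [conjTranspose_eq_transpose_of_trivial, mul_sub, sub_mul] at h1
  exact Matrix.le_iff.2 h1

lemma conj_assoc (χ a r : Mat d) : χᵀ * (a * r * a) * χ = χᵀ * a * r * a * χ := by
  simp only [mul_assoc]

/-! ### Entropic maps -/

lemma hasFDerivAt_bary {ν : Measure (Vec d)} [NeZero ν] (h : HasExpMoments ν) {χ : Mat d}
    {K : Kernel (Vec d) (Vec d)} (hK : ∀ x, K x = expTilt ν (χ *ᵥ x)) (x : Vec d) :
    HasFDerivAt (bary K) ((covMat (K x)).mulVecLin.toContinuousLinearMap.comp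
      χ.mulVecLin.toContinuousLinearMap) x := by
  have e : bary K = (fun θ => ∫ y, y ∂(expTilt ν θ)) ∘ χ.mulVecLin.toContinuousLinearMap := by
    funext x
    simp [bary, hK]
  rw [e, hK]
  exact (h.hasFDerivAt_mean (χ *ᵥ x)).comp x χ.mulVecLin.toContinuousLinearMap.hasFDerivAt

lemma gradMat_bary {ν : Measure (Vec d)} [NeZero ν] (h : HasExpMoments ν) {χ : Mat d}
    {K : Kernel (Vec d) (Vec d)} (hK : ∀ x, K x = expTilt ν (χ *ᵥ x)) (x : Vec d) :
    gradMat (bary K) x = χᵀ * covMat (K x) := by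
  ext i j
  rw [gradMat, Matrix.of_apply, (hasFDerivAt_bary h hK x).fderiv]
  simp only [ContinuousLinearMap.comp_apply, LinearMap.coe_toContinuousLinearMap',
    Matrix.mulVecLin_apply, Matrix.mulVec_single_one]
  simp only [mulVec, dotProduct, Matrix.mul_apply, transpose_apply, Matrix.col_apply]
  exact Finset.sum_congr rfl fun k _ => by rw [covMat_symm, mul_comm]

lemma condCov_eq_covMat (K : Kernel (Vec d) (Vec d)) (x : Vec d) : condCov K x = covMat (K x) := rfl

/-! ### The linear-Gaussian reference -/

lemma gibbsKernel_apply {W : Vec d → Vec d → ℝ} (hW : Measurable (Function.uncurry W))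
    (x : Vec d) : gibbsKernel W x = gibbs (W x) := by
  rw [gibbsKernel, Kernel.withDensity_apply, Kernel.const_apply]
  · rfl
  · exact hW.neg.exp.ennreal_ofReal

/-- The part of the linear-Gaussian potential depending only on the initial point; the cross terms
with `α` and the normalising constant of the Gaussian density are included here. -/
noncomputable def gaussLeft (α : Vec d) (β τ χ : Mat d) (x : Vec d) : ℝ :=
  Real.log (√((2 * Real.pi) • τ).det) + 1 / 2 * quad τ⁻¹ (β *ᵥ x) + α ⬝ᵥ (χ *ᵥ x)

/-- The part of the linear-Gaussian potential depending only on the final point. -/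
noncomputable def gaussRight (α : Vec d) (τ : Mat d) (y : Vec d) : ℝ :=
  1 / 2 * quad τ⁻¹ (y - α)

lemma continuous_quad (A : Mat d) : Continuous (quad A) := by
  have : quad A = fun x => ∑ i, x i * ∑ j, A i j * x j := by
    funext x
    rfl
  rw [this]
  fun_prop

lemma sqrt_det_pos {τ : Mat d} (hτ : τ.PosDef) : 0 < √((2 * Real.pi) • τ).det :=
  Real.sqrt_pos.2 (hτ.smul (by positivity)).det_pos

lemma linGaussPot_eq {α : Vec d} {β τ χ : Mat d} (hτ : τ.PosDef) (hχ : χ = τ⁻¹ * β)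
    (x y : Vec d) :
    linGaussPot α β τ x y = gaussLeft α β τ χ x + gaussRight α τ y - y ⬝ᵥ (χ *ᵥ x) := by
  have h0 := sqrt_det_pos hτ
  rw [linGaussPot, gaussDensity, Real.log_mul (inv_pos.2 h0).ne' (Real.exp_pos _).ne',
    Real.log_exp, Real.log_inv, gaussLeft, gaussRight]
  have e1 : y - (α + β *ᵥ x) = (y - α) - β *ᵥ x := by abel
  have e2 : χ *ᵥ x = τ⁻¹ *ᵥ (β *ᵥ x) := by rw [hχ, mulVec_mulVec]
  have e3 := dotProduct_mulVec_comm hτ.inv.isHermitian (β *ᵥ x) (y - α)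
  rw [e1, e2]
  simp only [quad, mulVec_sub τ⁻¹ (y - α) (β *ᵥ x), sub_dotProduct (y - α) (β *ᵥ x),
    dotProduct_sub _ (τ⁻¹ *ᵥ (y - α)), e3]
  rw [sub_dotProduct y α (τ⁻¹ *ᵥ (β *ᵥ x))]
  ring

lemma continuous_gaussLeft (α : Vec d) (β τ χ : Mat d) : Continuous (gaussLeft α β τ χ) := by
  have h1 : Continuous fun x : Vec d => quad τ⁻¹ (β *ᵥ x) :=
    (continuous_quad _).comp (continuous_const.matrix_mulVec continuous_id)
  have h2 : Continuous fun x : Vec d => α ⬝ᵥ (χ *ᵥ x) :=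
    continuous_const.dotProduct (continuous_const.matrix_mulVec continuous_id)
  exact (continuous_const.add (h1.const_mul _)).add h2

lemma continuous_gaussRight (α : Vec d) (τ : Mat d) : Continuous (gaussRight α τ) := by
  have h1 : Continuous fun y : Vec d => quad τ⁻¹ (y - α) :=
    (continuous_quad _).comp (continuous_id.sub continuous_const)
  exact h1.const_mul _

lemma measurable_linGaussPot {α : Vec d} {β τ χ : Mat d} (hτ : τ.PosDef) (hχ : χ = τ⁻¹ * β) :
    Measurable (Function.uncurry (linGaussPot α β τ)) := by
  have e : Function.uncurry (linGaussPot α β τ) = fun z : Vec d × Vec d =>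
      gaussLeft α β τ χ z.1 + gaussRight α τ z.2 - z.2 ⬝ᵥ (χ *ᵥ z.1) := by
    funext z
    exact linGaussPot_eq hτ hχ z.1 z.2
  rw [e]
  refine Continuous.measurable ?_
  exact (((continuous_gaussLeft α β τ χ).comp continuous_fst).add
    ((continuous_gaussRight α τ).comp continuous_snd)).sub
    (continuous_snd.dotProduct (continuous_const.matrix_mulVec continuous_fst))

lemma dotProduct_mulVec_transpose (χ : Mat d) (x y : Vec d) :
    y ⬝ᵥ (χ *ᵥ x) = (χᵀ *ᵥ y) ⬝ᵥ x := by
  rw [dotProduct_mulVec, mulVec_transpose]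

lemma hasExpMoments_of_surjective {q : Vec d → ℝ} (hq : Measurable q) {χ : Mat d} (hχ : IsUnit χ)
    {c : Vec d → ℝ} (h : ∀ x, Integrable fun y => Real.exp (-c x) * Real.exp ((χ *ᵥ x) ⬝ᵥ y - q y)) :
    HasExpMoments (gibbs q) := by
  intro θ
  obtain ⟨x, rfl⟩ := mulVec_surjective hχ θ
  rw [integrable_gibbs_iff hq]
  refine ((h x).const_mul (Real.exp (c x))).congr (Filter.Eventually.of_forall fun y => ?_)
  simp only [← Real.exp_add]
  ring_nf

lemma laplace_gibbs {q : Vec d → ℝ} (hq : Measurable q) (θ : Vec d) :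
    laplace (gibbs q) θ = ∫ y, Real.exp (θ ⬝ᵥ y - q y) := by
  rw [laplace, integral_gibbs hq]
  refine integral_congr_ae (Filter.Eventually.of_forall fun y => ?_)
  simp only [← Real.exp_add]
  ring_nf

/-- Absorbing the two marginal parts of the cost into the Schrödinger potentials leaves the
bilinear cost `-y · χ x`. -/
lemma IsSchrodingerPotentials.isDualPair_of_eq {U V : Vec d → ℝ} {W : Vec d → Vec d → ℝ}
    {χ : Mat d} {a b UU VV p q : Vec d → ℝ} (hχu : IsUnit χ) (hWm : Measurable (Function.uncurry W))
    (ha : Measurable a) (hb : Measurable b) (hW : ∀ x y, W x y = a x + b y - y ⬝ᵥ (χ *ᵥ x))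
    (h : IsSchrodingerPotentials U V W UU VV) (hpe : ∀ x, p x = UU x + a x)
    (hqe : ∀ y, q y = VV y + b y) : IsDualPair U V χ p q := by
  have hWm' : Measurable (Function.uncurry (flat W)) := hWm.comp measurable_swap
  have hWx : ∀ x, Measurable (W x) := fun x => hWm.of_uncurry_left
  have hWy : ∀ y, Measurable (flat W y) := fun y => hWm'.of_uncurry_left
  have mp : Measurable p := by
    rw [funext hpe]
    exact h.measurable_left.add ha
  have mq : Measurable q := by
    rw [funext hqe]
    exact h.measurable_right.add hb
  have ex : ∀ x y, Real.exp (-W x y) * Real.exp (-VV y)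
      = Real.exp (-a x) * Real.exp ((χ *ᵥ x) ⬝ᵥ y - q y) := by
    intro x y
    rw [← Real.exp_add, ← Real.exp_add, hW, dotProduct_comm, hqe]
    ring_nf
  have ey : ∀ y x, Real.exp (-flat W y x) * Real.exp (-UU x)
      = Real.exp (-b y) * Real.exp ((χᵀ *ᵥ y) ⬝ᵥ x - p x) := by
    intro y x
    rw [← Real.exp_add, ← Real.exp_add, flat, hW, dotProduct_mulVec_transpose, hpe]
    ring_nf
  have hq : HasExpMoments (gibbs q) := by
    refine hasExpMoments_of_surjective mq hχu (c := a) fun x => ?_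
    have := h.integrable_left x
    rw [gibbsKernel_apply hWm, integrable_gibbs_iff (hWx x)] at this
    simpa only [ex] using this
  have hp : HasExpMoments (gibbs p) := by
    refine hasExpMoments_of_surjective mp ((Matrix.isUnit_transpose _).2 hχu) (c := b) fun y => ?_
    have := h.integrable_right y
    rw [gibbsKernel_apply hWm', integrable_gibbs_iff (hWy y)] at this
    simpa only [ey] using this
  have := gibbs_neZero mp
  have := gibbs_neZero mq
  refine ⟨mp, mq, hp, hq, fun x => ?_, fun y => ?_⟩
  · have h1 := h.eq_left x
    rw [gibbsKernel_apply hWm, integral_gibbs (hWx x)] at h1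
    simp only [ex] at h1
    rw [integral_const_mul, ← laplace_gibbs mq, Real.log_mul (Real.exp_pos _).ne'
      (hq.laplace_pos _).ne', Real.log_exp] at h1
    linarith [hpe x]
  · have h1 := h.eq_right y
    rw [gibbsKernel_apply hWm', integral_gibbs (hWy y)] at h1
    simp only [ey] at h1
    rw [integral_const_mul, ← laplace_gibbs mp, Real.log_mul (Real.exp_pos _).ne'
      (hp.laplace_pos _).ne', Real.log_exp] at h1
    linarith [hqe y]

lemma IsSchrodingerPotentials.isDualPair {U V : Vec d → ℝ} {α : Vec d} {β τ χ : Mat d}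
    (hτ : τ.PosDef) (hχ : χ = τ⁻¹ * β) (hχu : IsUnit χ) {UU VV : Vec d → ℝ}
    (h : IsSchrodingerPotentials U V (linGaussPot α β τ) UU VV) :
    IsDualPair U V χ (fun x => UU x + gaussLeft α β τ χ x) (fun y => VV y + gaussRight α τ y) :=
  h.isDualPair_of_eq hχu (measurable_linGaussPot hτ hχ)
    (continuous_gaussLeft α β τ χ).measurable (continuous_gaussRight α τ).measurable
    (linGaussPot_eq hτ hχ) (fun _ => rfl) fun _ => rfl

lemma measurable_bridgePot {U : Vec d → ℝ} {W : Vec d → Vec d → ℝ} {UU VV : Vec d → ℝ}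
    (hU : Measurable U) (hW : Measurable (Function.uncurry W)) (hUU : Measurable UU)
    (hVV : Measurable VV) : Measurable (Function.uncurry (bridgePot U W UU VV)) :=
  (((hUU.comp measurable_fst).add hW).add (hVV.comp measurable_snd)).sub (hU.comp measurable_fst)

lemma measurable_bridgePotFlat {V : Vec d → ℝ} {W : Vec d → Vec d → ℝ} {UU VV : Vec d → ℝ}
    (hV : Measurable V) (hW : Measurable (Function.uncurry W)) (hUU : Measurable UU)
    (hVV : Measurable VV) : Measurable (Function.uncurry (bridgePotFlat V W UU VV)) :=
  (((hUU.comp measurable_snd).add (hW.comp measurable_swap)).add (hVV.comp measurable_fst)).sub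
    (hV.comp measurable_fst)

/-- The forward transition is an exponential family with parameter `χ x`. -/
lemma gibbsKernel_bridgePot {U V : Vec d → ℝ} (hU : Measurable U) {α : Vec d} {β τ χ : Mat d}
    (hτ : τ.PosDef) (hχ : χ = τ⁻¹ * β) (hχu : IsUnit χ) {UU VV : Vec d → ℝ}
    (h : IsSchrodingerPotentials U V (linGaussPot α β τ) UU VV) (x : Vec d) :
    gibbsKernel (bridgePot U (linGaussPot α β τ) UU VV) x
      = expTilt (gibbs fun y => VV y + gaussRight α τ y) (χ *ᵥ x) := by
  have hd := h.isDualPair hτ hχ hχu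
  rw [gibbsKernel_apply (measurable_bridgePot hU (measurable_linGaussPot hτ hχ)
    h.measurable_left h.measurable_right), expTilt_gibbs hd.measurable_right hd.hasExpMoments_right]
  congr 1
  funext y
  have := hd.eq_left x
  rw [bridgePot, linGaussPot_eq hτ hχ, dotProduct_comm]
  linarith

/-- The backward transition is an exponential family with parameter `χ' y`. -/
lemma gibbsKernel_bridgePotFlat {U V : Vec d → ℝ} (hV : Measurable V) {α : Vec d}
    {β τ χ : Mat d} (hτ : τ.PosDef) (hχ : χ = τ⁻¹ * β) (hχu : IsUnit χ) {UU VV : Vec d → ℝ}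
    (h : IsSchrodingerPotentials U V (linGaussPot α β τ) UU VV) (y : Vec d) :
    gibbsKernel (bridgePotFlat V (linGaussPot α β τ) UU VV) y
      = expTilt (gibbs fun x => UU x + gaussLeft α β τ χ x) (χᵀ *ᵥ y) := by
  have hd := h.isDualPair hτ hχ hχu
  rw [gibbsKernel_apply (measurable_bridgePotFlat hV (measurable_linGaussPot hτ hχ)
    h.measurable_left h.measurable_right), expTilt_gibbs hd.measurable_left hd.hasExpMoments_left]
  congr 1
  funext x
  have := hd.eq_right y
  rw [bridgePotFlat, linGaussPot_eq hτ hχ, dotProduct_mulVec_transpose]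
  linarith

/-! ### Relative entropy and couplings -/

/-- Truncation of a real number to the interval `[-n, n]`. -/
def clip (n : ℕ) (s : ℝ) : ℝ := max (-(n : ℝ)) (min s n)

lemma abs_clip_le (n : ℕ) (s : ℝ) : |clip n s| ≤ n := by
  have : (0 : ℝ) ≤ n := Nat.cast_nonneg n
  refine abs_le.2 ⟨le_max_left _ _, max_le (by linarith) (min_le_right _ _)⟩

lemma max_clip_add_clip_le (n : ℕ) (s t : ℝ) : max (clip n s + clip n t) 0 ≤ max (s + t) 0 := by
  have : (0 : ℝ) ≤ n := Nat.cast_nonneg n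
  simp only [clip, max_def, min_def]
  split_ifs <;> linarith

lemma clip_neg (n : ℕ) (s : ℝ) : clip n (-s) = -clip n s := by
  have : (0 : ℝ) ≤ n := Nat.cast_nonneg n
  simp only [clip, max_def, min_def]
  split_ifs <;> linarith

lemma max_neg_clip_add_clip_le (n : ℕ) (s t : ℝ) :
    max (-(clip n s + clip n t)) 0 ≤ max (-(s + t)) 0 := by
  have := max_clip_add_clip_le n (-s) (-t)
  rwa [clip_neg, clip_neg, ← neg_add, ← neg_add] at this

lemma clip_eq_self {n : ℕ} {s : ℝ} (h : |s| ≤ n) : clip n s = s := by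
  obtain ⟨h1, h2⟩ := abs_le.1 h
  rw [clip, min_eq_left h2, max_eq_right h1]

lemma tendsto_clip (s : ℝ) : Filter.Tendsto (fun n : ℕ => clip n s) Filter.atTop (nhds s) := by
  refine tendsto_const_nhds.congr' ?_
  obtain ⟨N, hN⟩ := exists_nat_ge |s|
  filter_upwards [Filter.eventually_ge_atTop N] with n hn
  exact (clip_eq_self (hN.trans (by exact_mod_cast hn))).symm

lemma measurable_clip (n : ℕ) : Measurable (clip n) :=
  measurable_const.max (measurable_id.min measurable_const)

lemma eq_max_sub_max (s : ℝ) : s = max s 0 - max (-s) 0 := by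
  rcases le_total s 0 with h | h
  · rw [max_eq_right h, max_eq_left (by linarith)]; ring
  · rw [max_eq_left h, max_eq_right (by linarith)]; ring

/-- Fatou's lemma, as a criterion for integrability. -/
lemma integrable_of_tendsto_of_integral_le {Ω : Type*} [MeasurableSpace Ω] {π : Measure Ω}
    {F : ℕ → Ω → ℝ} {f : Ω → ℝ} (hF : ∀ n, Measurable (F n)) (hF0 : ∀ n x, 0 ≤ F n x)
    (hFi : ∀ n, Integrable (F n) π) {C : ℝ} (hC : ∀ n, ∫ x, F n x ∂π ≤ C)
    (hlim : ∀ x, Filter.Tendsto (fun n => F n x) Filter.atTop (nhds (f x))) :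
    Integrable f π := by
  have hf : Measurable f := measurable_of_tendsto_metrizable hF (tendsto_pi_nhds.2 hlim)
  have hf0 : ∀ x, 0 ≤ f x := fun x => ge_of_tendsto' (hlim x) fun n => hF0 n x
  refine ⟨hf.aestronglyMeasurable, ?_⟩
  rw [hasFiniteIntegral_iff_ofReal (Filter.Eventually.of_forall hf0)]
  have e : ∀ x, ENNReal.ofReal (f x)
      = Filter.liminf (fun n => ENNReal.ofReal (F n x)) Filter.atTop := fun x =>
    ((ENNReal.continuous_ofReal.tendsto _).comp (hlim x)).liminf_eq.symm
  simp only [e]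
  refine (lintegral_liminf_le fun n => (hF n).ennreal_ofReal).trans_lt ?_
  refine lt_of_le_of_lt (b := ENNReal.ofReal C) ?_ ENNReal.ofReal_lt_top
  refine Filter.liminf_le_of_le (by isBoundedDefault) fun b hb => ?_
  obtain ⟨n, hn⟩ := hb.exists
  refine hn.trans ?_
  rw [← ofReal_integral_eq_lintegral_ofReal (hFi n) (Filter.Eventually.of_forall (hF0 n))]
  exact ENNReal.ofReal_le_ofReal (hC n)

section Couplings

variable {X Y : Type*} [MeasurableSpace X] [MeasurableSpace Y]

/-- A sum `f(x) + g(y)` whose negative part is integrable for one coupling and whose positive part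
is integrable for another coupling of the same marginals is integrable for both, with the same
integral, even if `f` and `g` are not integrable separately. Truncating `f` and `g` separately
shrinks the positive and negative parts of the sum, so that Fatou's lemma and dominated convergence
apply. -/
lemma integrable_add_of_coupling {Q₁ Q₂ : Measure (X × Y)} [IsFiniteMeasure Q₁]
    [IsFiniteMeasure Q₂] (hfst : Q₁.fst = Q₂.fst) (hsnd : Q₁.snd = Q₂.snd) {f : X → ℝ} {g : Y → ℝ}
    (hf : Measurable f) (hg : Measurable g)
    (h1 : Integrable (fun z => max (-(f z.1 + g z.2)) 0) Q₁)
    (h2 : Integrable (fun z => max (f z.1 + g z.2) 0) Q₂) :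
    Integrable (fun z => f z.1 + g z.2) Q₁ ∧ Integrable (fun z => f z.1 + g z.2) Q₂ ∧
      ∫ z, (f z.1 + g z.2) ∂Q₁ = ∫ z, (f z.1 + g z.2) ∂Q₂ := by
  set H : ℕ → X × Y → ℝ := fun n z => clip n (f z.1) + clip n (g z.2) with hH
  have mf : ∀ n, Measurable fun x => clip n (f x) := fun n => (measurable_clip n).comp hf
  have mg : ∀ n, Measurable fun y => clip n (g y) := fun n => (measurable_clip n).comp hg
  have mH : ∀ n, Measurable (H n) := fun n =>
    ((mf n).comp measurable_fst).add ((mg n).comp measurable_snd)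
  have bI : ∀ {Ω : Type _} [MeasurableSpace Ω] (π : Measure Ω) [IsFiniteMeasure π] {F : Ω → ℝ}
      (_ : Measurable F) (C : ℝ) (_ : ∀ x, |F x| ≤ C), Integrable F π := fun π _ F hF C hC =>
    Integrable.of_bound hF.aestronglyMeasurable C (Filter.Eventually.of_forall hC)
  have iH : ∀ (Q : Measure (X × Y)) [IsFiniteMeasure Q] n, Integrable (H n) Q := fun Q _ n =>
    bI Q (mH n) (n + n) fun z => (abs_add_le _ _).trans
      (add_le_add (abs_clip_le _ _) (abs_clip_le _ _))
  have eH : ∀ (Q : Measure (X × Y)) [IsFiniteMeasure Q] n,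
      ∫ z, H n z ∂Q = ∫ x, clip n (f x) ∂Q.fst + ∫ y, clip n (g y) ∂Q.snd := by
    intro Q _ n
    rw [Measure.fst, Measure.snd, integral_map measurable_fst.aemeasurable
      (mf n).aestronglyMeasurable, integral_map measurable_snd.aemeasurable
      (mg n).aestronglyMeasurable, ← integral_add]
    · exact bI Q ((mf n).comp measurable_fst) n fun z => abs_clip_le _ _
    · exact bI Q ((mg n).comp measurable_snd) n fun z => abs_clip_le _ _
  have eH12 : ∀ n, ∫ z, H n z ∂Q₁ = ∫ z, H n z ∂Q₂ := fun n => by rw [eH, eH, hfst, hsnd]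
  have iP : ∀ (Q : Measure (X × Y)) [IsFiniteMeasure Q] n, Integrable (fun z => max (H n z) 0) Q :=
    fun Q _ n => (iH Q n).pos_part
  have iN : ∀ (Q : Measure (X × Y)) [IsFiniteMeasure Q] n,
      Integrable (fun z => max (-(H n z)) 0) Q := fun Q _ n => (iH Q n).neg_part
  have split : ∀ (Q : Measure (X × Y)) [IsFiniteMeasure Q] n,
      ∫ z, H n z ∂Q = ∫ z, max (H n z) 0 ∂Q - ∫ z, max (-(H n z)) 0 ∂Q := by
    intro Q _ n
    rw [← integral_sub (iP Q n) (iN Q n)]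
    exact integral_congr_ae (Filter.Eventually.of_forall fun z => eq_max_sub_max _)
  have lim : ∀ z, Filter.Tendsto (fun n => H n z) Filter.atTop (nhds (f z.1 + g z.2)) := fun z =>
    (tendsto_clip _).add (tendsto_clip _)
  have b1 : ∀ n, ∫ z, max (-(H n z)) 0 ∂Q₁ ≤ ∫ z, max (-(f z.1 + g z.2)) 0 ∂Q₁ := fun n =>
    integral_mono (iN Q₁ n) h1 fun z => max_neg_clip_add_clip_le n _ _
  have b2 : ∀ n, ∫ z, max (H n z) 0 ∂Q₂ ≤ ∫ z, max (f z.1 + g z.2) 0 ∂Q₂ := fun n =>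
    integral_mono (iP Q₂ n) h2 fun z => max_clip_add_clip_le n _ _
  have n1 : ∀ n, 0 ≤ ∫ z, max (H n z) 0 ∂Q₁ := fun n => integral_nonneg fun z => le_max_right _ _
  have n2 : ∀ n, 0 ≤ ∫ z, max (-(H n z)) 0 ∂Q₂ := fun n =>
    integral_nonneg fun z => le_max_right _ _
  set C := ∫ z, max (-(f z.1 + g z.2)) 0 ∂Q₁ + ∫ z, max (f z.1 + g z.2) 0 ∂Q₂ with hC
  have p1 : Integrable (fun z : X × Y => max (f z.1 + g z.2) 0) Q₁ := by
    refine integrable_of_tendsto_of_integral_le (F := fun n z => max (H n z) 0)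
      (fun n => (mH n).max measurable_const) (fun n z => le_max_right _ _) (iP Q₁) (C := C)
      (fun n => ?_) fun z => (lim z).max tendsto_const_nhds
    linarith [b1 n, b2 n, n2 n, split Q₁ n, split Q₂ n, eH12 n]
  have p2 : Integrable (fun z : X × Y => max (-(f z.1 + g z.2)) 0) Q₂ := by
    refine integrable_of_tendsto_of_integral_le (F := fun n z => max (-(H n z)) 0)
      (fun n => (mH n).neg.max measurable_const) (fun n z => le_max_right _ _) (iN Q₂) (C := C)
      (fun n => ?_) fun z => (lim z).neg.max tendsto_const_nhds
    linarith [b1 n, b2 n, n1 n, split Q₁ n, split Q₂ n, eH12 n]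
  have J1 : Integrable (fun z : X × Y => f z.1 + g z.2) Q₁ :=
    (p1.sub h1).congr (Filter.Eventually.of_forall fun z => (eq_max_sub_max _).symm)
  have J2 : Integrable (fun z : X × Y => f z.1 + g z.2) Q₂ :=
    (h2.sub p2).congr (Filter.Eventually.of_forall fun z => (eq_max_sub_max _).symm)
  have dom : ∀ n (z : X × Y), ‖H n z‖ ≤ |f z.1 + g z.2| := by
    intro n z
    have h3 := max_clip_add_clip_le n (f z.1) (g z.2)
    have h4 := max_neg_clip_add_clip_le n (f z.1) (g z.2)
    rw [Real.norm_eq_abs]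
    refine abs_le'.2 ⟨?_, ?_⟩
    · exact ((le_max_left _ _).trans h3).trans (max_le (le_abs_self _) (abs_nonneg _))
    · exact ((le_max_left _ _).trans h4).trans (max_le (neg_le_abs _) (abs_nonneg _))
  have L1 := tendsto_integral_of_dominated_convergence (μ := Q₁) (F := H) _
    (fun n => (mH n).aestronglyMeasurable) J1.abs
    (fun n => Filter.Eventually.of_forall (dom n)) (Filter.Eventually.of_forall lim)
  have L2 := tendsto_integral_of_dominated_convergence (μ := Q₂) (F := H) _
    (fun n => (mH n).aestronglyMeasurable) J2.abs
    (fun n => Filter.Eventually.of_forall (dom n)) (Filter.Eventually.of_forall lim)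
  refine ⟨J1, J2, tendsto_nhds_unique L1 ?_⟩
  simpa only [eH12] using L2

end Couplings

/-- The negative part of the log-likelihood ratio is always integrable, as `ρ log ρ ≥ -1`. -/
lemma integrable_neg_part_llr {Ω : Type*} [MeasurableSpace Ω] {μ ν : Measure Ω} [IsFiniteMeasure μ]
    [IsFiniteMeasure ν] (h : μ ≪ ν) : Integrable (fun x => max (-llr μ ν x) 0) μ := by
  rw [← integrable_rnDeriv_smul_iff h]
  refine Integrable.of_bound (C := 1) ?_ (Filter.Eventually.of_forall fun x => ?_)
  · exact ((Measure.measurable_rnDeriv μ ν).ennreal_toReal.smul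
      ((measurable_llr μ ν).neg.max measurable_const)).aestronglyMeasurable
  · have h0 : 0 ≤ ((∂μ/∂ν) x).toReal := ENNReal.toReal_nonneg
    rw [smul_eq_mul, Real.norm_of_nonneg (mul_nonneg h0 (le_max_right _ _)),
      mul_max_of_nonneg _ _ h0]
    refine max_le ?_ (by simp)
    have := Real.negMulLog_le_one_sub_self h0
    rw [Real.negMulLog] at this
    rw [llr]
    linarith

section Bridge

variable {X Y : Type*} [MeasurableSpace X] [MeasurableSpace Y]

/-- The Pythagorean identity for the relative entropy, when the density of the coupling
`P.tilted (f ⊕ g)` with respect to the reference splits into functions of the marginals. -/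
lemma klDiv_eq_add_klDiv_tilted {P Q : Measure (X × Y)} [IsFiniteMeasure P]
    [IsProbabilityMeasure Q] {f : X → ℝ} {g : Y → ℝ} (hf : Measurable f) (hg : Measurable g)
    (hi : Integrable (fun z : X × Y => Real.exp (f z.1 + g z.2)) P)
    (h1 : ∫ z, Real.exp (f z.1 + g z.2) ∂P = 1)
    (hfst : (P.tilted fun z => f z.1 + g z.2).fst = Q.fst)
    (hsnd : (P.tilted fun z => f z.1 + g z.2).snd = Q.snd)
    (hQ : InformationTheory.klDiv Q P ≠ ⊤) :
    InformationTheory.klDiv (P.tilted fun z => f z.1 + g z.2) P ≠ ⊤ ∧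
      InformationTheory.klDiv Q P
        = InformationTheory.klDiv Q (P.tilted fun z => f z.1 + g z.2)
          + InformationTheory.klDiv (P.tilted fun z => f z.1 + g z.2) P := by
  have hP0 : NeZero P := ⟨fun h => by simp [h] at h1⟩
  set R := P.tilted fun z => f z.1 + g z.2 with hR
  have hRP : IsProbabilityMeasure R := isProbabilityMeasure_tilted hi
  obtain ⟨hac, hint⟩ := InformationTheory.klDiv_ne_top_iff.1 hQ
  have hPR : P ≪ R := absolutelyContinuous_tilted hi
  have hRac : R ≪ P := tilted_absolutelyContinuous _ _
  have hQR : Q ≪ R := hac.trans hPR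
  have e1 : llr Q R =ᵐ[Q] fun z => -(f z.1 + g z.2) + llr Q P z := by
    filter_upwards [llr_tilted_right hac hi] with z hz
    rw [hR, hz, h1, Real.log_one, add_zero]
  have e2 : llr R P =ᵐ[R] fun z => f z.1 + g z.2 := by
    refine hRac.ae_eq ?_
    filter_upwards [log_rnDeriv_tilted_left_self hi] with z hz
    rw [llr, hz, h1, Real.log_one, sub_zero]
  have i1 : Integrable (fun z => max (-(f z.1 + g z.2)) 0) R := by
    refine (integrable_neg_part_llr hRac).congr ?_
    filter_upwards [e2] with z hz
    rw [hz]
  have mh : Measurable fun z : X × Y => f z.1 + g z.2 :=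
    (hf.comp measurable_fst).add (hg.comp measurable_snd)
  have i2 : Integrable (fun z => max (f z.1 + g z.2) 0) Q := by
    refine (hint.abs.add (integrable_neg_part_llr hQR)).mono'
      (mh.max measurable_const).aestronglyMeasurable ?_
    filter_upwards [e1] with z hz
    rw [Real.norm_of_nonneg (le_max_right _ _)]
    have h2 := le_abs_self (llr Q P z)
    have h3 := le_max_left (-llr Q R z) 0
    have h4 := le_max_right (-llr Q R z) 0
    have h5 := abs_nonneg (llr Q P z)
    refine max_le ?_ (add_nonneg h5 h4)
    simp only [Pi.add_apply]
    linarith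
  obtain ⟨j1, j2, hj⟩ := integrable_add_of_coupling hfst hsnd hf hg i1 i2
  have k1 : Integrable (llr R P) R := j1.congr e2.symm
  have k2 : Integrable (llr Q R) Q := (j2.neg.add hint).congr e1.symm
  refine ⟨InformationTheory.klDiv_ne_top hRac k1, ?_⟩
  have n1 := InformationTheory.integral_llr_add_sub_measure_univ_nonneg hQR k2
  have n2 := InformationTheory.integral_llr_add_sub_measure_univ_nonneg hRac k1
  rw [InformationTheory.klDiv_of_ac_of_integrable hac hint,
    InformationTheory.klDiv_of_ac_of_integrable hQR k2,
    InformationTheory.klDiv_of_ac_of_integrable hRac k1, ← ENNReal.ofReal_add n1 n2,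
    integral_congr_ae e1, integral_congr_ae e2,
    integral_add (f := fun z => -(f z.1 + g z.2)) j2.neg hint, hj, integral_neg]
  congr 1
  simp only [probReal_univ]
  ring

end Bridge

/-! ### The Schrödinger bridge -/

lemma lintegral_gibbs {U : Vec d → ℝ} (hU : Measurable U) {f : Vec d → ENNReal}
    (hf : Measurable f) :
    ∫⁻ x, f x ∂(gibbs U) = ∫⁻ x, ENNReal.ofReal (Real.exp (-U x)) * f x := by
  rw [gibbs, lintegral_withDensity_eq_lintegral_mul _ (measurable_ofReal_exp_neg hU) hf]
  rfl

/-- The joint density of a Gibbs measure and a Gibbs kernel. -/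
lemma gibbs_compProd_gibbsKernel {U : Vec d → ℝ} (hU : Measurable U) [SFinite (gibbs U)]
    {F : Vec d → Vec d → ℝ} (hF : Measurable (Function.uncurry F)) :
    gibbs U ⊗ₘ gibbsKernel F = ((volume : Measure (Vec d)).prod volume).withDensity
      fun z => ENNReal.ofReal (Real.exp (-(U z.1 + F z.1 z.2))) := by
  have hF' : Measurable fun z : Vec d × Vec d => F z.1 z.2 := hF
  have hD : Measurable fun z : Vec d × Vec d =>
      ENNReal.ofReal (Real.exp (-(U z.1 + F z.1 z.2))) := by fun_prop
  refine Measure.ext_of_lintegral _ fun f hf => ?_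
  rw [Measure.lintegral_compProd hf, lintegral_withDensity_eq_lintegral_mul _ hD hf,
    lintegral_prod _ (hD.mul hf).aemeasurable,
    lintegral_gibbs hU (Measurable.lintegral_kernel_prod_right' hf)]
  refine lintegral_congr fun x => ?_
  have hFx : Measurable (F x) := hF.of_uncurry_left
  rw [gibbsKernel_apply hF, lintegral_gibbs hFx (f := fun y => f (x, y)) (hf.comp measurable_prodMk_left),
    ← lintegral_const_mul _ (by fun_prop)]
  refine lintegral_congr fun y => ?_
  rw [Pi.mul_apply, neg_add, Real.exp_add, ENNReal.ofReal_mul (Real.exp_pos _).le, mul_assoc]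

lemma map_swap_withDensity {D : Vec d × Vec d → ENNReal} (hD : Measurable D) :
    (((volume : Measure (Vec d)).prod volume).withDensity D).map Prod.swap
      = ((volume : Measure (Vec d)).prod volume).withDensity fun z => D z.swap := by
  have hD' : Measurable fun z : Vec d × Vec d => D z.swap := hD.comp measurable_swap
  refine Measure.ext_of_lintegral _ fun f hf => ?_
  rw [lintegral_map hf measurable_swap, lintegral_withDensity_eq_lintegral_mul _ hD
    (g := fun z => f z.swap) (hf.comp measurable_swap), lintegral_withDensity_eq_lintegral_mul _
    hD' hf, ← lintegral_prod_swap]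
  rfl

/-- The two bridge transitions are time reversals of each other: both joint laws have the density
`exp (-(UU(x) + W(x,y) + VV(y)))`. -/
lemma gibbs_compProd_bridge_swap {U V : Vec d → ℝ} (hU : Measurable U) (hV : Measurable V)
    [SFinite (gibbs U)] [SFinite (gibbs V)] {W : Vec d → Vec d → ℝ}
    (hW : Measurable (Function.uncurry W)) {UU VV : Vec d → ℝ} (hUU : Measurable UU)
    (hVV : Measurable VV) :
    (gibbs V) ⊗ₘ gibbsKernel (bridgePotFlat V W UU VV)
      = ((gibbs U) ⊗ₘ gibbsKernel (bridgePot U W UU VV)).map Prod.swap := by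
  have hb := measurable_bridgePot hU hW hUU hVV
  have hb' : Measurable fun z : Vec d × Vec d => bridgePot U W UU VV z.1 z.2 := hb
  rw [gibbs_compProd_gibbsKernel hV (measurable_bridgePotFlat hV hW hUU hVV),
    gibbs_compProd_gibbsKernel hU hb, map_swap_withDensity (by fun_prop)]
  congr 1
  funext z
  simp [bridgePot, bridgePotFlat]

/-- The joint law of the forward bridge transition has the density `exp (f(x) + g(y))`, with
`f = U - UU` and `g = -VV`, with respect to the reference. -/
lemma gibbs_compProd_bridge_eq_tilted {U : Vec d → ℝ} (hU : Measurable U) [SFinite (gibbs U)]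
    {W : Vec d → Vec d → ℝ} (hW : Measurable (Function.uncurry W)) {UU VV : Vec d → ℝ}
    (hUU : Measurable UU) (hVV : Measurable VV)
    [IsProbabilityMeasure ((gibbs U) ⊗ₘ gibbsKernel (bridgePot U W UU VV))] :
    Integrable (fun z : Vec d × Vec d => Real.exp ((U z.1 - UU z.1) + -VV z.2))
      ((gibbs U) ⊗ₘ gibbsKernel W) ∧
    ∫ z, Real.exp ((U z.1 - UU z.1) + -VV z.2) ∂((gibbs U) ⊗ₘ gibbsKernel W) = 1 ∧
    ((gibbs U) ⊗ₘ gibbsKernel W).tilted (fun z => (U z.1 - UU z.1) + -VV z.2)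
      = (gibbs U) ⊗ₘ gibbsKernel (bridgePot U W UU VV) := by
  have hW' : Measurable fun z : Vec d × Vec d => W z.1 z.2 := hW
  have hh : Measurable fun z : Vec d × Vec d => (U z.1 - UU z.1) + -VV z.2 := by fun_prop
  have e : ((gibbs U) ⊗ₘ gibbsKernel W).withDensity
      (fun z => ENNReal.ofReal (Real.exp ((U z.1 - UU z.1) + -VV z.2)))
      = (gibbs U) ⊗ₘ gibbsKernel (bridgePot U W UU VV) := by
    rw [gibbs_compProd_gibbsKernel hU hW,
      gibbs_compProd_gibbsKernel hU (measurable_bridgePot hU hW hUU hVV),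
      ← withDensity_mul _ (by fun_prop) (by fun_prop)]
    congr 1
    funext z
    rw [Pi.mul_apply, ← ENNReal.ofReal_mul (Real.exp_pos _).le, ← Real.exp_add]
    congr 2
    simp only [bridgePot]
    ring
  have hlint : ∫⁻ z, ENNReal.ofReal (Real.exp ((U z.1 - UU z.1) + -VV z.2))
      ∂((gibbs U) ⊗ₘ gibbsKernel W) = 1 := by
    rw [← setLIntegral_univ, ← withDensity_apply _ MeasurableSet.univ, e, measure_univ]
  have hint : Integrable (fun z : Vec d × Vec d => Real.exp ((U z.1 - UU z.1) + -VV z.2))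
      ((gibbs U) ⊗ₘ gibbsKernel W) := by
    refine ⟨hh.exp.aestronglyMeasurable, ?_⟩
    rw [hasFiniteIntegral_iff_ofReal (Filter.Eventually.of_forall fun z => (Real.exp_pos _).le),
      hlint]
    exact ENNReal.one_lt_top
  have h1 : ∫ z, Real.exp ((U z.1 - UU z.1) + -VV z.2) ∂((gibbs U) ⊗ₘ gibbsKernel W) = 1 := by
    rw [integral_eq_lintegral_of_nonneg_ae (Filter.Eventually.of_forall fun z =>
      (Real.exp_pos _).le) hh.exp.aestronglyMeasurable, hlint, ENNReal.toReal_one]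
  refine ⟨hint, h1, ?_⟩
  rw [Measure.tilted, h1, ← e]
  simp only [div_one]

/-- When some coupling has finite entropy, the joint law of the forward transition is the unique
Schrödinger bridge, by the Pythagorean identity. -/
theorem isSchrodingerBridge_iff {U V : Vec d → ℝ} (hU : Measurable U)
    [IsProbabilityMeasure (gibbs U)] {W : Vec d → Vec d → ℝ}
    (hW : Measurable (Function.uncurry W)) {UU VV : Vec d → ℝ}
    (hUU : Measurable UU) (hVV : Measurable VV) [IsFiniteMeasure ((gibbs U) ⊗ₘ gibbsKernel W)]
    [IsMarkovKernel (gibbsKernel (bridgePot U W UU VV))]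
    (hsnd : ((gibbs U) ⊗ₘ gibbsKernel (bridgePot U W UU VV)).snd = gibbs V)
    (hex : ∃ Q : Measure (Vec d × Vec d), Q.fst = gibbs U ∧ Q.snd = gibbs V ∧
      InformationTheory.klDiv Q ((gibbs U) ⊗ₘ gibbsKernel W) ≠ ⊤) (Q : Measure (Vec d × Vec d)) :
    IsSchrodingerBridge ((gibbs U) ⊗ₘ gibbsKernel W) (gibbs U) (gibbs V) Q ↔
      Q = (gibbs U) ⊗ₘ gibbsKernel (bridgePot U W UU VV) := by
  obtain ⟨hi, h1, he⟩ := gibbs_compProd_bridge_eq_tilted hU hW hUU hVV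
  have hfst : ((gibbs U) ⊗ₘ gibbsKernel (bridgePot U W UU VV)).fst = gibbs U :=
    Measure.fst_compProd _ _
  have hprob : ∀ Q : Measure (Vec d × Vec d), Q.fst = gibbs U → IsProbabilityMeasure Q := by
    intro Q hQ
    refine ⟨?_⟩
    rw [← Measure.fst_univ, hQ, measure_univ]
  set P := (gibbs U) ⊗ₘ gibbsKernel W
  set R := (gibbs U) ⊗ₘ gibbsKernel (bridgePot U W UU VV)
  have pyth : ∀ Q : Measure (Vec d × Vec d), Q.fst = gibbs U → Q.snd = gibbs V →
      InformationTheory.klDiv Q P ≠ ⊤ → InformationTheory.klDiv R P ≠ ⊤ ∧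
        InformationTheory.klDiv Q P
          = InformationTheory.klDiv Q R + InformationTheory.klDiv R P := by
    intro Q hQ1 hQ2 hQ3
    have := hprob Q hQ1
    have key := klDiv_eq_add_klDiv_tilted (P := P) (Q := Q) (f := fun x => U x - UU x)
      (g := fun y => -VV y) (hU.sub hUU) hVV.neg hi h1 (by rw [he, hfst, hQ1])
      (by rw [he, hsnd, hQ2]) hQ3
    rwa [he] at key
  obtain ⟨Q₀, hQ₀1, hQ₀2, hQ₀3⟩ := hex
  have hRfin := (pyth Q₀ hQ₀1 hQ₀2 hQ₀3).1
  have := hprob R hfst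
  constructor
  · rintro ⟨hQ1, hQ2, hQ3, hmin⟩
    have := hprob Q hQ1
    have h2 := hmin R hfst hsnd
    rw [(pyth Q hQ1 hQ2 hQ3).2] at h2
    have h3 : InformationTheory.klDiv Q R = 0 := by
      have h4 : InformationTheory.klDiv Q R + InformationTheory.klDiv R P
          ≤ 0 + InformationTheory.klDiv R P := by rwa [zero_add]
      exact le_antisymm ((ENNReal.add_le_add_iff_right hRfin).1 h4) zero_le
    exact InformationTheory.klDiv_eq_zero_iff.1 h3
  · rintro rfl
    refine ⟨hfst, hsnd, hRfin, fun Q' hQ1 hQ2 => ?_⟩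
    by_cases hQ3 : InformationTheory.klDiv Q' P = ⊤
    · rw [hQ3]
      exact le_top
    · rw [(pyth Q' hQ1 hQ2 hQ3).2]
      exact le_add_self

/-! ### Finiteness of the Gaussian reference -/

lemma gaussDensity_pos {τ : Mat d} (hτ : τ.PosDef) (z : Vec d) : 0 < gaussDensity τ z :=
  mul_pos (inv_pos.2 (sqrt_det_pos hτ)) (Real.exp_pos _)

lemma integrable_gaussDensity {τ : Mat d} (hτ : τ.PosDef) : Integrable (gaussDensity τ) := by
  obtain ⟨c, hc, hq⟩ := exists_pos_le_quad hτ.inv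
  have h1 : Integrable fun z : Vec d => ∏ i, Real.exp (-(c / 2) * z i ^ 2) :=
    Integrable.fintype_prod (f := fun _ s => Real.exp (-(c / 2) * s ^ 2))
      fun _ => integrable_exp_neg_mul_sq (half_pos hc)
  have hm : Continuous (gaussDensity τ) := by
    have : Continuous fun z : Vec d => z ⬝ᵥ (τ⁻¹ *ᵥ z) := continuous_quad τ⁻¹
    unfold gaussDensity
    fun_prop
  refine (h1.const_mul (√((2 * Real.pi) • τ).det)⁻¹).mono' hm.aestronglyMeasurable
    (Filter.Eventually.of_forall fun z => ?_)
  have h0 : 0 ≤ (√((2 * Real.pi) • τ).det)⁻¹ := (inv_pos.2 (sqrt_det_pos hτ)).le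
  rw [Real.norm_of_nonneg (gaussDensity_pos hτ z).le, gaussDensity, ← Real.exp_sum]
  refine mul_le_mul_of_nonneg_left (Real.exp_le_exp.2 ?_) h0
  have h2 := hq z
  have h3 : ∑ i, -(c / 2) * z i ^ 2 = -(c / 2) * (z ⬝ᵥ z) := by
    rw [← Finset.mul_sum, dotProduct]
    simp only [sq]
  rw [quad] at h2
  rw [h3]
  linarith

/-- The total mass of the reference transition does not depend on the initial point, by translation
invariance. -/
lemma isFiniteKernel_linGaussPot {α : Vec d} {β τ χ : Mat d} (hτ : τ.PosDef) (hχ : χ = τ⁻¹ * β) :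
    IsFiniteKernel (gibbsKernel (linGaussPot α β τ)) := by
  refine ⟨∫⁻ z, ENNReal.ofReal (gaussDensity τ z), ?_, fun x => ?_⟩
  · have := (integrable_gaussDensity hτ).2
    rwa [hasFiniteIntegral_iff_ofReal (Filter.Eventually.of_forall fun z =>
      (gaussDensity_pos hτ z).le)] at this
  · rw [gibbsKernel_apply (measurable_linGaussPot hτ hχ), gibbs,
      withDensity_apply _ MeasurableSet.univ, setLIntegral_univ,
      ← lintegral_sub_right_eq_self (fun z => ENNReal.ofReal (gaussDensity τ z)) (α + β *ᵥ x)]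
    refine (lintegral_congr fun y => ?_).le
    rw [linGaussPot, neg_neg, Real.exp_log (gaussDensity_pos hτ _)]

end EntropicMap

theorem mainTheorem7 {d : ℕ}
    (U V : Vec d → ℝ) (hU : ContDiff ℝ 2 U) (hV : ContDiff ℝ 2 V)
    (hμ : IsProbabilityMeasure (gibbs U)) (hη : IsProbabilityMeasure (gibbs V))
    (α : Vec d) (β τ χ : Mat d) (hβ : IsUnit β) (hτ : τ.PosDef) (hχ : χ = τ⁻¹ * β)
    (W : Vec d → Vec d → ℝ) (hW : W = linGaussPot α β τ)
    (UU VV : Vec d → ℝ) (hUV : IsSchrodingerPotentials U V W UU VV)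
    (K Kb : Kernel (Vec d) (Vec d))
    (hK : K = gibbsKernel (bridgePot U W UU VV))
    (hKb : Kb = gibbsKernel (bridgePotFlat V W UU VV)) :
    -- `K` and `Kb` are the forward and backward transitions of the Schrödinger bridge
    (IsMarkovKernel K ∧ IsMarkovKernel Kb ∧
      (gibbs V) ⊗ₘ Kb = ((gibbs U) ⊗ₘ K).map Prod.swap ∧
      ((∃ Q : Measure (Vec d × Vec d), Q.fst = gibbs U ∧ Q.snd = gibbs V ∧
          InformationTheory.klDiv Q ((gibbs U) ⊗ₘ gibbsKernel W) ≠ ⊤) →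
        ∀ Q : Measure (Vec d × Vec d),
          IsSchrodingerBridge ((gibbs U) ⊗ₘ gibbsKernel W) (gibbs U) (gibbs V) Q ↔
            Q = (gibbs U) ⊗ₘ K)) ∧
    -- the entropic maps and the conditional covariances are well defined, and the former are smooth
    ((∀ x, MemLp (fun y : Vec d => y) 2 (K x)) ∧ (∀ y, MemLp (fun x : Vec d => x) 2 (Kb y)) ∧
      Differentiable ℝ (bary K) ∧ Differentiable ℝ (bary Kb)) ∧
    -- conditional covariance identities
    ((∀ x, χᵀ * condCov K x * χ = gradMat (bary K) x * χ) ∧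
      (∀ y, χ * condCov Kb y * χᵀ = gradMat (bary Kb) y * χᵀ)) ∧
    -- bounds under `∇²U ≤ u₋⁻¹` and `v₊⁻¹ ≤ ∇²V` (no upper bound on `∇²U` when `u₋ = 0`)
    (∀ um vp : Mat d, (um = 0 ∨ um.PosDef) → vp.PosDef →
      (um ≠ 0 → ∀ x, hess U x ≤ um⁻¹) → (∀ y, vp⁻¹ ≤ hess V y) →
      (∀ x, gradMat (bary K) x * χ ≤
        χᵀ * msqrt vp * riccFixOfInv (msqrt vp * (χ * um * χᵀ) * msqrt vp) * msqrt vp * χ) ∧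
      (∀ y, χ * msqrt um * riccFixOfInv (msqrt um * (χᵀ * vp * χ) * msqrt um) * msqrt um * χᵀ ≤
        gradMat (bary Kb) y * χᵀ)) ∧
    -- bounds under `u₊⁻¹ ≤ ∇²U` and `∇²V ≤ v₋⁻¹` (no upper bound on `∇²V` when `v₋ = 0`)
    (∀ up vm : Mat d, up.PosDef → (vm = 0 ∨ vm.PosDef) →
      (∀ x, up⁻¹ ≤ hess U x) → (vm ≠ 0 → ∀ y, hess V y ≤ vm⁻¹) →
      (∀ y, gradMat (bary Kb) y * χᵀ ≤
        χ * msqrt up * riccFixOfInv (msqrt up * (χᵀ * vm * χ) * msqrt up) * msqrt up * χᵀ) ∧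
      (∀ x, χᵀ * msqrt vm * riccFixOfInv (msqrt vm * (χ * up * χᵀ) * msqrt vm) * msqrt vm * χ ≤
        gradMat (bary K) x * χ)) := by
  subst hW hK hKb
  have hχu : IsUnit χ := hχ ▸ hτ.inv.isUnit.mul hβ
  have hd := hUV.isDualPair hτ hχ hχu
  have hKx := gibbsKernel_bridgePot hU.continuous.measurable hτ hχ hχu hUV
  have hKy := gibbsKernel_bridgePotFlat hV.continuous.measurable hτ hχ hχu hUV
  have hWm := measurable_linGaussPot (α := α) hτ hχ
  have hp0 := gibbs_neZero hd.measurable_left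
  have hq0 := gibbs_neZero hd.measurable_right
  have hMK : IsMarkovKernel (gibbsKernel (bridgePot U (linGaussPot α β τ) UU VV)) :=
    ⟨fun x => by rw [hKx]; exact hd.hasExpMoments_right.isProbabilityMeasure_expTilt _⟩
  have hMKb : IsMarkovKernel (gibbsKernel (bridgePotFlat V (linGaussPot α β τ) UU VV)) :=
    ⟨fun y => by rw [hKy]; exact hd.hasExpMoments_left.isProbabilityMeasure_expTilt _⟩
  have hfin := isFiniteKernel_linGaussPot (α := α) hτ hχ
  have hswap := gibbs_compProd_bridge_swap hU.continuous.measurable hV.continuous.measurable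
    hWm hUV.measurable_left hUV.measurable_right
  have hsnd : ((gibbs U) ⊗ₘ gibbsKernel (bridgePot U (linGaussPot α β τ) UU VV)).snd
      = gibbs V := by
    rw [← Measure.fst_map_swap, ← hswap, Measure.fst_compProd]
  have hgK := gradMat_bary hd.hasExpMoments_right hKx
  have hgKb := gradMat_bary hd.hasExpMoments_left hKy
  rw [transpose_transpose] at hgKb
  refine ⟨⟨hMK, hMKb, hswap, fun hex Q => ?_⟩, ⟨fun x => ?_, fun y => ?_, fun x => ?_, fun y => ?_⟩,
    ⟨fun x => ?_, fun y => ?_⟩, fun um vp hum hvp hUu hVv => ?_, fun up vm hup hvm hUu hVv => ?_⟩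
  · exact isSchrodingerBridge_iff hU.continuous.measurable hWm hUV.measurable_left
      hUV.measurable_right hsnd hex Q
  · rw [hKx]
    exact hd.hasExpMoments_right.memLp_two_expTilt _
  · rw [hKy]
    exact hd.hasExpMoments_left.memLp_two_expTilt _
  · exact (hasFDerivAt_bary hd.hasExpMoments_right hKx x).differentiableAt
  · exact (hasFDerivAt_bary hd.hasExpMoments_left hKy y).differentiableAt
  · rw [hgK, condCov_eq_covMat]
  · rw [hgKb, condCov_eq_covMat]
  · obtain ⟨h1, h2⟩ := hd.riccati_bounds hU hV hχu hum hvp hUu hVv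
    refine ⟨fun x => ?_, fun y => ?_⟩
    · rw [hgK, hKx, ← conj_assoc]
      exact conj_le_conj (h1 x) χ
    · have h := conj_le_conj (h2 y) χᵀ
      rw [conj_assoc, transpose_transpose] at h
      rw [hgKb, hKy]
      exact h
  -- the other two bounds are those of the system with the two marginals exchanged
  · obtain ⟨h1, h2⟩ := hd.swap.riccati_bounds hV hU ((Matrix.isUnit_transpose _).2 hχu) hvm hup hVv hUu
    rw [transpose_transpose] at h1 h2
    refine ⟨fun y => ?_, fun x => ?_⟩
    · have h := conj_le_conj (h1 y) χᵀ
      rw [conj_assoc, transpose_transpose] at h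
      rw [hgKb, hKy]
      exact h
    · rw [hgK, hKx, ← conj_assoc]
      exact conj_le_conj (h2 x) χ
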